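/- **Theorem 3.** The model is the word RAM with $w$-bit words: constantly many registers, a read-only input memory, a read-write working memory with arbitrary initial contents, and a write-only output; each instruction (arithmetic and bitwise operations modulo $2^w$, memory access, comparison, output) takes one time unit. A graph with vertex set $\{0,\dots,n-1\}$ is given as a plain adjacency array in the input memory: an array of length $n$ whose $v$-th entry is a pointer to an array that stores the length of the list of (out-)neighbours of $v$, followed by these neighbours, each once, in some order. There are no cross pointers, and the placement of the arrays is arbitrary. The program is given $n$ and $w$ in registers. There are a single word RAM program and constants $k, C$ (independent of the graph, of its representation and of $w$) such that for every directed graph (self-loops allowed) and every simple undirected graph with $n\ge 1$ vertices and $m$ edges, given as an adjacency array, and for every word size $w \ge \lceil\log_2(n+m+1)\rceil + k$, the program performs a depth-first search traversal of the whole graph in at most $C(n+m)$ time steps, using at most $C(n+m+w)$ bits for its registers and its working memory together; that is, it runs in $O(m+n)$ time with $O(m+n)$ bits of working space besides $O(1)$ machine words, hence with $O(m+n)$ bits in all as long as $w = O(m+n)$. Here, performing the traversal means writing to the output, in order, the events "discover $v$" and "finish $v$" of the recursive depth-first search that tries $0,1,\dots,n-1$ in this order as roots and scans the neighbours of every vertex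 in the order of its array. -/

import Mathlib

/-! ## Depth-first search -/

/-- `adj u` lists the (out-)neighbours of `u` with respect to the adjacency relation `Adj`,
each exactly once, in an arbitrary order. -/
def ListsNeighbors {n : ℕ} (Adj : Fin n → Fin n → Prop) (adj : Fin n → List (Fin n)) : Prop :=
  ∀ u, (adj u).Nodup ∧ ∀ v, v ∈ adj u ↔ Adj u v

/-- The events of a depth-first traversal: discovering a vertex, and finishing it (backtracking
out of it after its whole neighbour list has been scanned). -/
inductive DFSEvent (V : Type) where
  | enter (v : V)
  | exit (v : V)

/-- `DFSScan adj vs S es S'`: scanning the vertices `vs` from left to right, recursively visiting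
each one that is still undiscovered when its turn comes, and starting with the set `S` of
discovered vertices, produces the events `es` and ends with the set `S'` of discovered vertices. -/
inductive DFSScan {V : Type} [DecidableEq V] (adj : V → List V) :
    List V → Finset V → List (DFSEvent V) → Finset V → Prop where
  | nil (S : Finset V) : DFSScan adj [] S [] S
  | skip {v : V} {vs : List V} {S S' : Finset V} {es : List (DFSEvent V)} :
      v ∈ S → DFSScan adj vs S es S' → DFSScan adj (v :: vs) S es S'
  | visit {v : V} {vs : List V} {S S₁ S₂ : Finset V} {es₁ es₂ : List (DFSEvent V)} :
      v ∉ S → DFSScan adj (adj v) (insert v S) es₁ S₁ → DFSScan adj vs S₁ es₂ S₂ →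
      DFSScan adj (v :: vs) S (DFSEvent.enter v :: es₁ ++ DFSEvent.exit v :: es₂) S₂

/-- `es` is the event sequence of the depth-first traversal of the whole graph: the vertices
`0, …, n - 1` are tried as roots in this order, neighbours in the order of the lists `adj`. -/
def IsDFSTraversal {n : ℕ} (adj : Fin n → List (Fin n)) (es : List (DFSEvent (Fin n))) : Prop :=
  ∃ S, DFSScan adj (List.finRange n) ∅ es S

/-- Each event is reported as two output words: a tag and the index of the vertex. -/
def DFSEvent.encode {n : ℕ} : DFSEvent (Fin n) → List ℕ
  | .enter v => [0, v]
  | .exit v => [1, v]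

/-! ## The word RAM

Words are natural numbers below `2 ^ w`. A program has finitely many registers, a read-only input
memory, a read-write working memory and a write-only output stream. Every elementary instruction
and every evaluation of a test takes one time unit. Programs are written with structured control
flow, i.e. conditional jumps are used only in the form of `if` and `while`. -/

namespace WordRAM

/-- The arithmetic and bitwise operations on words. -/
inductive Op where
  | add | sub | mul | div | mod | and | or | xor | shl | shr

/-- All results are reduced modulo `2 ^ w`. -/
def Op.eval (w : ℕ) : Op → ℕ → ℕ → ℕ
  | .add, x, y => (x + y) % 2 ^ w
  | .sub, x, y => (x + (2 ^ w - y)) % 2 ^ w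
  | .mul, x, y => (x * y) % 2 ^ w
  | .div, x, y => (x / y) % 2 ^ w
  | .mod, x, y => (x % y) % 2 ^ w
  | .and, x, y => (x &&& y) % 2 ^ w
  | .or, x, y => (x ||| y) % 2 ^ w
  | .xor, x, y => (x ^^^ y) % 2 ^ w
  | .shl, x, y => (x <<< y) % 2 ^ w
  | .shr, x, y => (x >>> y) % 2 ^ w

/-- Elementary instructions; `d`, `a`, `b`, `s` are register indices. -/
inductive Instr where
  /-- put the constant `k` into register `d` -/
  | const (d k : ℕ)
  /-- copy register `a` to register `d` -/
  | move (d a : ℕ)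
  /-- apply `o` to registers `a` and `b`, result into register `d` -/
  | op (o : Op) (d a b : ℕ)
  /-- read into `d` the input cell whose address is in `a` -/
  | readInput (d a : ℕ)
  /-- read into `d` the working cell whose address is in `a` -/
  | load (d a : ℕ)
  /-- write register `s` to the working cell whose address is in `a` -/
  | store (a s : ℕ)
  /-- append register `s` to the output -/
  | output (s : ℕ)

/-- Comparisons of two registers. -/
inductive Test where
  | lt (a b : ℕ)
  | le (a b : ℕ)
  | eq (a b : ℕ)
  | ne (a b : ℕ)

/-- Word RAM programs. -/
inductive Program where
  | skip
  | instr (i : Instr)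
  | seq (P Q : Program)
  | ite (b : Test) (P Q : Program)
  | loop (b : Test) (P : Program)

/-- Configurations. `time` counts the steps made so far, and `cells` is the least number such that
only working cells with addresses below `cells` have been accessed so far. -/
structure State where
  reg : ℕ → ℕ
  work : ℕ → ℕ
  out : List ℕ
  time : ℕ
  cells : ℕ

def State.setReg (σ : State) (d x : ℕ) : State :=
  { σ with reg := Function.update σ.reg d x }

/-- Charge one time unit. -/
def State.tick (σ : State) : State :=
  { σ with time := σ.time + 1 }

/-- Record an access to working cell `a`. -/
def State.touch (σ : State) (a : ℕ) : State :=
  { σ with cells := max σ.cells (a + 1) }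

/-- Effect of an instruction, for word size `w` and input memory `inp`. -/
def Instr.exec (w : ℕ) (inp : ℕ → ℕ) : Instr → State → State
  | .const d k, σ => (σ.setReg d (k % 2 ^ w)).tick
  | .move d a, σ => (σ.setReg d (σ.reg a)).tick
  | .op o d a b, σ => (σ.setReg d (o.eval w (σ.reg a) (σ.reg b))).tick
  | .readInput d a, σ => (σ.setReg d (inp (σ.reg a))).tick
  | .load d a, σ => ((σ.setReg d (σ.work (σ.reg a))).touch (σ.reg a)).tick
  | .store a s, σ =>
      (({ σ with work := Function.update σ.work (σ.reg a) (σ.reg s) }).touch (σ.reg a)).tick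
  | .output s, σ => ({ σ with out := σ.out ++ [σ.reg s] }).tick

def Test.Holds (σ : State) : Test → Prop
  | .lt a b => σ.reg a < σ.reg b
  | .le a b => σ.reg a ≤ σ.reg b
  | .eq a b => σ.reg a = σ.reg b
  | .ne a b => σ.reg a ≠ σ.reg b

/-- `P.Runs w inp σ τ`: started in `σ`, the program `P` terminates, in configuration `τ`. -/
inductive Program.Runs (w : ℕ) (inp : ℕ → ℕ) : Program → State → State → Prop where
  | skip (σ : State) : Program.Runs w inp .skip σ σ
  | instr (i : Instr) (σ : State) : Program.Runs w inp (.instr i) σ (i.exec w inp σ)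
  | seq {P Q : Program} {σ τ υ : State} :
      Program.Runs w inp P σ τ → Program.Runs w inp Q τ υ → Program.Runs w inp (.seq P Q) σ υ
  | ite_true {b : Test} {P Q : Program} {σ τ : State} :
      b.Holds σ → Program.Runs w inp P σ.tick τ → Program.Runs w inp (.ite b P Q) σ τ
  | ite_false {b : Test} {P Q : Program} {σ τ : State} :
      ¬ b.Holds σ → Program.Runs w inp Q σ.tick τ → Program.Runs w inp (.ite b P Q) σ τ
  | loop_true {b : Test} {P : Program} {σ τ υ : State} :
      b.Holds σ → Program.Runs w inp P σ.tick τ → Program.Runs w inp (.loop b P) τ υ →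
      Program.Runs w inp (.loop b P) σ υ
  | loop_false {b : Test} {P : Program} {σ : State} :
      ¬ b.Holds σ → Program.Runs w inp (.loop b P) σ σ.tick

/-- A number exceeding all register indices that occur in the instruction. -/
def Instr.regs : Instr → ℕ
  | .const d _ => d + 1
  | .move d a => max d a + 1
  | .op _ d a b => max d (max a b) + 1
  | .readInput d a => max d a + 1
  | .load d a => max d a + 1
  | .store a s => max a s + 1
  | .output s => s + 1

def Test.regs : Test → ℕ
  | .lt a b => max a b + 1
  | .le a b => max a b + 1
  | .eq a b => max a b + 1
  | .ne a b => max a b + 1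

/-- The number of registers of a program. -/
def Program.regs : Program → ℕ
  | .skip => 0
  | .instr i => i.regs
  | .seq P Q => max P.regs Q.regs
  | .ite b P Q => max b.regs (max P.regs Q.regs)
  | .loop b P => max b.regs P.regs

/-- Initially register `0` holds the number `n` of vertices, register `1` holds the word size, all
other registers hold `0`, and the working memory has the (arbitrary) contents `work`. -/
def initial (n w : ℕ) (work : ℕ → ℕ) : State where
  reg i := if i = 0 then n else if i = 1 then w else 0
  work := work
  out := []
  time := 0
  cells := 0

/-- The input memory holds the plain adjacency array with neighbour lists `adj`: an array of length
`n` at address `0`, whose `v`-th entry is a pointer to an array that stores the neighbours of `v`,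
preceded by its length. Nothing is assumed about the placement of these arrays. -/
structure IsAdjacencyArray {n : ℕ} (w : ℕ) (adj : Fin n → List (Fin n)) (inp : ℕ → ℕ) : Prop where
  word : ∀ a, inp a < 2 ^ w
  fits : ∀ v : Fin n, inp v + (adj v).length < 2 ^ w
  length : ∀ v : Fin n, inp (inp v) = (adj v).length
  neighbor : ∀ (v : Fin n) (j : ℕ) (hj : j < (adj v).length), inp (inp v + 1 + j) = (adj v)[j]

/-- On every adjacency array with neighbour lists `adj`, with words of `w` bits and whatever the
working memory contains at the start, `P` terminates after at most `T` steps, has then written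
the depth-first traversal to the output, and has used at most `B` bits for its registers and
working memory together. -/
def PerformsDFS (P : Program) {n : ℕ} (adj : Fin n → List (Fin n)) (w T B : ℕ) : Prop :=
  ∀ inp work : ℕ → ℕ, IsAdjacencyArray w adj inp → (∀ a, work a < 2 ^ w) →
    ∃ (τ : State) (es : List (DFSEvent (Fin n))),
      P.Runs w inp (initial n w work) τ ∧
      IsDFSTraversal adj es ∧ τ.out = es.flatMap DFSEvent.encode ∧
      τ.time ≤ T ∧ w * (P.regs + τ.cells) ≤ B

end WordRAM

/-! ## The search in linear space

A stack entry consists of a vertex `u` and a position in its neighbour list. With `ℓ` the bit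
length of `n` plus the sum of all degrees, the position is stored in `min (deg u) ℓ` bits, so that
all positions together take `O(m)` bits. The vertices of the search path would take `Θ(n log n)`
bits; only those of at most `ℓ` consecutive levels at the end of the path are kept, in a cyclic
buffer of `ℓ²` bits. On each level divisible by `ℓ`, the vertex and the top of the stack of
positions are recorded permanently, in `2 ℓ` bits. When the buffer has run empty, it is
rebuilt from the last such checkpoint: a vertex determines the size of its field on the stack of
positions, hence the position stored there and with it the vertex of the next level.

Rebuilding replays at most `ℓ` levels, and the buffer runs empty only after as many steps back. So
the time plus a multiple of the number of levels missing in the buffer grows by a constant per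
step. Bit fields of less than `w` bits are accessed in `O(1)` time through the two words that
contain them.
-/

theorem DFSScan.subset {V : Type} [DecidableEq V] {adj : V → List V} {vs : List V}
    {S S' : Finset V} {es : List (DFSEvent V)} (h : DFSScan adj vs S es S') : S ⊆ S' := by
  induction h with
  | nil => exact subset_rfl
  | skip _ _ ih => exact ih
  | visit _ _ _ ih₁ ih₂ => exact ((Finset.subset_insert _ _).trans ih₁).trans ih₂

theorem DFSScan.exists {V : Type} [DecidableEq V] [Finite V] (adj : V → List V) (S : Finset V)
    (vs : List V) : ∃ es S', DFSScan adj vs S es S' := by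
  cases nonempty_fintype V
  induction hk : Fintype.card V - S.card using Nat.strong_induction_on generalizing S vs with
  | _ k ih_insert =>
    suffices ∀ S₁, S ⊆ S₁ → ∃ es S', DFSScan adj vs S₁ es S' from this S subset_rfl
    induction vs with
    | nil => exact fun S₁ _ => ⟨[], S₁, .nil S₁⟩
    | cons v vs ih_tail =>
      intro S₁ hS
      by_cases hv : v ∈ S₁
      · obtain ⟨es, S', h⟩ := ih_tail S₁ hS
        exact ⟨es, S', .skip hv h⟩
      · have hins := Finset.card_insert_of_notMem hv
        have hle := Finset.card_le_univ (insert v S₁)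
        have hsub := Finset.card_le_card hS
        obtain ⟨es₁, S₂, h₁⟩ := ih_insert _ (by omega) (insert v S₁) (adj v) rfl
        obtain ⟨es₂, S₃, h₂⟩ :=
          ih_tail S₂ ((hS.trans (Finset.subset_insert _ _)).trans h₁.subset)
        exact ⟨_, S₃, .visit hv h₁ h₂⟩

namespace WordRAM

/-! ## Bit fields -/

/-- The number whose binary digits are the `f` bits at address `p`, least significant first. -/
def readBits (M : ℕ → Bool) (p f : ℕ) : ℕ :=
  Nat.ofBits fun i : Fin f => M (p + i)

/-- Replace the `f` bits at address `p` by the binary digits of `x`. -/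
def writeBits (M : ℕ → Bool) (p f x : ℕ) : ℕ → Bool :=
  fun q => if p ≤ q ∧ q < p + f then x.testBit (q - p) else M q

section BitFields

variable {M N : ℕ → Bool} {p f x q g : ℕ}

theorem testBit_readBits (M : ℕ → Bool) (p f i : ℕ) :
    (readBits M p f).testBit i = (decide (i < f) && M (p + i)) := by
  rw [readBits, Nat.testBit_ofBits]
  by_cases h : i < f <;> simp [h]

theorem readBits_lt (M : ℕ → Bool) (p f : ℕ) : readBits M p f < 2 ^ f :=
  Nat.ofBits_lt_two_pow _

theorem readBits_one (M : ℕ → Bool) (p : ℕ) : readBits M p 1 = (M p).toNat := by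
  simp [readBits, Nat.ofBits_succ]

theorem readBits_congr (h : ∀ i < f, M (p + i) = N (p + i)) :
    readBits M p f = readBits N p f :=
  congrArg Nat.ofBits (funext fun i => h i i.2)

theorem readBits_writeBits_self (hx : x < 2 ^ f) :
    readBits (writeBits M p f x) p f = x := by
  refine Nat.eq_of_testBit_eq fun i => ?_
  rw [testBit_readBits]
  by_cases h : i < f
  · simp [h, writeBits]
  · simp [h, Nat.testBit_eq_false_of_lt (hx.trans_le (Nat.pow_le_pow_right two_pos (not_lt.1 h)))]

theorem writeBits_of_outside (h : q < p ∨ p + f ≤ q) : writeBits M p f x q = M q :=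
  if_neg (by omega)

theorem readBits_writeBits_of_disjoint (h : q + g ≤ p ∨ p + f ≤ q) :
    readBits (writeBits M p f x) q g = readBits M q g :=
  readBits_congr fun _ _ => writeBits_of_outside (by omega)

theorem writeBits_eq_xor (M : ℕ → Bool) (p : ℕ) (hx : x < 2 ^ f) (q : ℕ) :
    writeBits M p f x q =
      (M q ^^ (decide (p ≤ q) && (readBits M p f ^^^ x).testBit (q - p))) := by
  simp only [writeBits, Nat.testBit_xor, testBit_readBits]
  rcases lt_or_ge q p with hq | hq
  · simp [hq.not_ge]
  obtain ⟨i, rfl⟩ := Nat.exists_eq_add_of_le hq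
  by_cases hi : i < f
  · simp [hi]
  · simp [hi, Nat.testBit_eq_false_of_lt
      (hx.trans_le (Nat.pow_le_pow_right two_pos (not_lt.1 hi)))]

end BitFields

/-! ## A language of commands over a bit-addressed memory -/

/-- The variables of the depth-first search: the number `num` of vertices, the field width `ell`
and the addresses `ck`, `js` of the tables of checkpoints and of positions; the current vertex
`cur`, the index `pos` of the next neighbour to look at and the depth `dep`; the first buffered
level `lo` and the length `top` of the stack of positions; scratch variables. The variable `zero`
is never assigned, so it holds `0` and serves as a constant in comparisons. -/
inductive Var where
  | num | ell | ck | js | cur | pos | dep | lo | top | flag | root | zero | total | pw | deg | nbr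
  | col | lvl | off | len

/-- The register that holds a variable. Register `1` is left out because it holds the word size. -/
def Var.idx : Var → ℕ
  | num => 0 | ell => 2 | ck => 3 | js => 4 | cur => 5 | pos => 6 | dep => 7 | lo => 8 | top => 9
  | flag => 10 | root => 11 | zero => 12 | total => 13 | pw => 14 | deg => 15 | nbr => 16
  | col => 17 | lvl => 18 | off => 19 | len => 20

theorem Var.idx_lt (a : Var) : a.idx < 40 := by cases a <;> simp [Var.idx]

theorem Var.idx_ne_one (a : Var) : a.idx ≠ 1 := by cases a <;> simp [Var.idx]

theorem Var.idx_inj {a b : Var} : a.idx = b.idx ↔ a = b := by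
  cases a <;> cases b <;> simp [Var.idx]

instance : DecidableEq Var := fun _ _ => decidable_of_iff _ Var.idx_inj

/-- The operations of expressions. -/
inductive Arith where
  | add | sub | mul | mod

/-- The word operation that implements an operation. -/
def Arith.toOp : Arith → Op
  | add => .add | sub => .sub | mul => .mul | mod => .mod

/-- The value over the natural numbers. -/
def Arith.val : Arith → ℕ → ℕ → ℕ
  | add, x, y => x + y
  | sub, x, y => x - y
  | mul, x, y => x * y
  | mod, x, y => x % y

/-- Neither overflow nor truncation occurs, so that `Arith.val` agrees with the word operation. -/
def Arith.Fits (w : ℕ) : Arith → ℕ → ℕ → Prop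
  | add, x, y => x + y < 2 ^ w
  | sub, x, y => y ≤ x
  | mul, x, y => x * y < 2 ^ w
  | mod, _, _ => True

theorem Arith.eval_toOp {w x y : ℕ} (o : Arith) (hx : x < 2 ^ w) (h : o.Fits w x y) :
    o.toOp.eval w x y = o.val x y := by
  cases o <;> simp only [toOp, Op.eval, val, Fits] at *
  · exact Nat.mod_eq_of_lt h
  · obtain h' | h' : x + (2 ^ w - y) = x - y + 2 ^ w ∨ 2 ^ w < y := by omega
    · rw [h', Nat.add_mod_right, Nat.mod_eq_of_lt (by omega)]
    · omega
  · exact Nat.mod_eq_of_lt h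
  · exact Nat.mod_eq_of_lt ((Nat.mod_le _ _).trans_lt hx)

/-- Expressions over the variables and the input memory. -/
inductive Expr where
  | const (k : ℕ)
  | var (a : Var)
  | arith (o : Arith) (a b : Expr)
  | input (a : Expr)

/-- The value of an expression under the assignment `ρ`, over the natural numbers. -/
def Expr.val (inp : ℕ → ℕ) (ρ : Var → ℕ) : Expr → ℕ
  | const k => k
  | var a => ρ a
  | arith o a b => o.val (a.val inp ρ) (b.val inp ρ)
  | input a => inp (a.val inp ρ)

/-- The expression can be evaluated over words without overflow or truncation. -/
def Expr.Fits (w : ℕ) (inp : ℕ → ℕ) (ρ : Var → ℕ) : Expr → Prop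
  | const k => k < 2 ^ w
  | var _ => True
  | arith o a b =>
      a.Fits w inp ρ ∧ b.Fits w inp ρ ∧ o.Fits w (a.val inp ρ) (b.val inp ρ)
  | input a => a.Fits w inp ρ

/-- The number of steps that the evaluation of an expression takes. -/
def Expr.cost : Expr → ℕ
  | const _ => 1
  | var _ => 1
  | arith _ a b => a.cost + b.cost + 1
  | input a => a.cost + 1

prefix:max "◇" => Expr.var
prefix:max "♯" => Expr.const

instance : Add Expr := ⟨.arith .add⟩
instance : Sub Expr := ⟨.arith .sub⟩
instance : Mul Expr := ⟨.arith .mul⟩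
instance : Mod Expr := ⟨.arith .mod⟩

theorem Expr.add_def (a b : Expr) : a + b = .arith .add a b := rfl

theorem Expr.sub_def (a b : Expr) : a - b = .arith .sub a b := rfl

theorem Expr.mul_def (a b : Expr) : a * b = .arith .mul a b := rfl

theorem Expr.mod_def (a b : Expr) : a % b = .arith .mod a b := rfl

/-- Comparisons of two variables. -/
inductive Cond where
  | lt (a b : Var)
  | le (a b : Var)
  | eq (a b : Var)
  | ne (a b : Var)

/-- The word RAM test that implements a comparison. -/
def Cond.toTest : Cond → Test
  | lt a b => .lt a.idx b.idx
  | le a b => .le a.idx b.idx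
  | eq a b => .eq a.idx b.idx
  | ne a b => .ne a.idx b.idx

/-- The comparison is true under the assignment `ρ`. -/
def Cond.Holds (ρ : Var → ℕ) : Cond → Prop
  | lt a b => ρ a < ρ b
  | le a b => ρ a ≤ ρ b
  | eq a b => ρ a = ρ b
  | ne a b => ρ a ≠ ρ b

/-- Programs over the variables and a working memory that is an array of bits. -/
inductive Cmd where
  | skip
  | set (d : Var) (e : Expr)
  | out (e : Expr)
  /-- read the `f` bits at bit address `a` into the variable `d` -/
  | rd (d : Var) (a f : Expr)
  /-- write `s` to the `f` bits at bit address `a` -/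
  | wr (a f s : Expr)
  | seq (c₁ c₂ : Cmd)
  | ite (b : Cond) (c₁ c₂ : Cmd)
  | loop (b : Cond) (c : Cmd)

infixr:60 ";;" => Cmd.seq

/-- Configurations of a program that sees its working memory as an array of bits. -/
structure BState where
  reg : Var → ℕ
  mem : ℕ → Bool
  out : List ℕ
  time : ℕ

/-- Charge one time unit. -/
def BState.tick (A : BState) : BState := { A with time := A.time + 1 }

/-- Weakest precondition of a loop with condition `b` whose body has the predicate transformer
`body`. -/
inductive LoopWP (b : Cond) (body : (BState → Prop) → BState → Prop) (Q : BState → Prop) :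
    BState → Prop where
  | done {A : BState} : ¬ b.Holds A.reg → Q A.tick → LoopWP b body Q A
  | step {A : BState} (R : BState → Prop) : b.Holds A.reg → body R A.tick →
      (∀ B, R B → LoopWP b body Q B) → LoopWP b body Q A

/-- Weakest precondition for total correctness, for word size `w`, input memory `inp` and bit
addresses up to `N`. The constants `13` and `22` are the costs of the code sequences that transfer
a bit field. -/
def Cmd.wp (w : ℕ) (inp : ℕ → ℕ) (N : ℕ) : Cmd → (BState → Prop) → BState → Prop
  | skip, Q, A => Q A
  | set d e, Q, A => e.Fits w inp A.reg ∧
      Q { A with reg := Function.update A.reg d (e.val inp A.reg), time := A.time + e.cost + 1 }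
  | out e, Q, A => e.Fits w inp A.reg ∧
      Q { A with out := A.out ++ [e.val inp A.reg], time := A.time + e.cost + 1 }
  | rd d a f, Q, A => a.Fits w inp A.reg ∧ f.Fits w inp A.reg ∧
      a.val inp A.reg ≤ N ∧ f.val inp A.reg < w ∧
      Q { A with
            reg := Function.update A.reg d (readBits A.mem (a.val inp A.reg) (f.val inp A.reg)),
            time := A.time + a.cost + f.cost + 13 }
  | wr a f s, Q, A => a.Fits w inp A.reg ∧ f.Fits w inp A.reg ∧ s.Fits w inp A.reg ∧
      a.val inp A.reg ≤ N ∧ f.val inp A.reg < w ∧ s.val inp A.reg < 2 ^ (f.val inp A.reg) ∧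
      Q { A with
            mem := writeBits A.mem (a.val inp A.reg) (f.val inp A.reg) (s.val inp A.reg),
            time := A.time + a.cost + f.cost + s.cost + 22 }
  | seq c₁ c₂, Q, A => c₁.wp w inp N (c₂.wp w inp N Q) A
  | ite b c₁ c₂, Q, A => (b.Holds A.reg → c₁.wp w inp N Q A.tick) ∧
      (¬ b.Holds A.reg → c₂.wp w inp N Q A.tick)
  | loop b c, Q, A => LoopWP b (c.wp w inp N) Q A

/-! ## Compilation to word RAM programs -/

section Simulation

variable {w : ℕ} {inp : ℕ → ℕ}

/-- A straight-line program. -/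
def block : List Instr → Program
  | [] => .skip
  | i :: l => .seq (.instr i) (block l)

/-- The effect of a straight-line program. -/
def execList (w : ℕ) (inp : ℕ → ℕ) : List Instr → State → State
  | [], σ => σ
  | i :: l, σ => execList w inp l (i.exec w inp σ)

theorem runs_block (l : List Instr) (σ : State) :
    (block l).Runs w inp σ (execList w inp l σ) := by
  induction l generalizing σ with
  | nil => exact .skip σ
  | cons i l ih => exact .seq (.instr i σ) (ih _)

/-- All registers and working cells hold words. -/
structure Bounded (w : ℕ) (σ : State) : Prop where
  reg : ∀ r, σ.reg r < 2 ^ w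
  work : ∀ a, σ.work a < 2 ^ w

theorem Bounded.tick {σ : State} (h : Bounded w σ) : Bounded w σ.tick :=
  ⟨h.reg, h.work⟩

theorem update_lt_of_lt {B : ℕ} {g : ℕ → ℕ} (hg : ∀ r, g r < B) (d : ℕ) {x : ℕ} (hx : x < B)
    (r : ℕ) : Function.update g d x r < B := by
  rw [Function.update_apply]
  split_ifs
  exacts [hx, hg r]

theorem Bounded.exec {σ : State} (hinp : ∀ a, inp a < 2 ^ w) (h : Bounded w σ) (i : Instr) :
    Bounded w (i.exec w inp σ) := by
  have hpos : 0 < 2 ^ w := by positivity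
  cases i with
  | const d k => exact ⟨update_lt_of_lt h.reg d (Nat.mod_lt _ hpos), h.work⟩
  | move d a => exact ⟨update_lt_of_lt h.reg d (h.reg a), h.work⟩
  | op o d a b =>
    refine ⟨update_lt_of_lt h.reg d ?_, h.work⟩
    cases o <;> exact Nat.mod_lt _ hpos
  | readInput d a => exact ⟨update_lt_of_lt h.reg d (hinp _), h.work⟩
  | load d a => exact ⟨update_lt_of_lt h.reg d (h.work _), h.work⟩
  | store a s => exact ⟨h.reg, update_lt_of_lt h.work _ (h.reg s)⟩
  | output s => exact ⟨h.reg, h.work⟩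

theorem Bounded.runs (hinp : ∀ a, inp a < 2 ^ w) {P : Program} {σ τ : State}
    (hr : P.Runs w inp σ τ) (h : Bounded w σ) : Bounded w τ := by
  induction hr with
  | skip => exact h
  | instr i σ => exact h.exec hinp i
  | seq _ _ ih₁ ih₂ => exact ih₂ (ih₁ h)
  | ite_true _ _ ih => exact ih h.tick
  | ite_false _ _ ih => exact ih h.tick
  | loop_true _ _ _ ih₁ ih₂ => exact ih₂ (ih₁ h.tick)
  | loop_false => exact h.tick

/-- The bits of a memory of `w`-bit words. -/
def bits (w : ℕ) (work : ℕ → ℕ) : ℕ → Bool := fun p => (work (p / w)).testBit (p % w)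

/-- The bit-level configuration `A` describes `σ`, and only bit addresses up to `N` have been
used. Since a bit field may extend into the next word, this allows for `N / w + 2` cells. -/
structure Describes (w N : ℕ) (A : BState) (σ : State) : Prop where
  bounded : Bounded w σ
  wordSize : σ.reg 1 = w
  reg : ∀ a : Var, σ.reg a.idx = A.reg a
  mem : bits w σ.work = A.mem
  out : σ.out = A.out
  time : σ.time = A.time
  cells : σ.cells ≤ N / w + 2

section Describes

variable {N : ℕ} {A : BState} {σ : State}

theorem Describes.tick (h : Describes w N A σ) : Describes w N A.tick σ.tick :=
  ⟨h.bounded.tick, h.wordSize, h.reg, h.mem, h.out, congrArg (· + 1) h.time, h.cells⟩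

theorem Describes.holds_iff (h : Describes w N A σ) (b : Cond) :
    b.toTest.Holds σ ↔ b.Holds A.reg := by
  cases b <;> simp [Cond.toTest, Test.Holds, Cond.Holds, h.reg]

theorem Describes.setReg (h : Describes w N A σ) {t x : ℕ} (ht : 40 ≤ t) (hx : x < 2 ^ w) :
    Describes w N A (σ.setReg t x) where
  bounded := ⟨update_lt_of_lt h.bounded.reg t hx, h.bounded.work⟩
  wordSize := (Function.update_of_ne (by omega) _ _).trans h.wordSize
  reg a := (Function.update_of_ne (by have := a.idx_lt; omega) _ _).trans (h.reg a)
  mem := h.mem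
  out := h.out
  time := h.time
  cells := h.cells

theorem Describes.move (h : Describes w N A σ) (d : Var) (t : ℕ) :
    Describes w N { A with reg := Function.update A.reg d (σ.reg t), time := A.time + 1 }
      ((Instr.move d.idx t).exec w inp σ) where
  bounded := ⟨update_lt_of_lt h.bounded.reg d.idx (h.bounded.reg t), h.bounded.work⟩
  wordSize := (Function.update_of_ne d.idx_ne_one.symm _ _).trans h.wordSize
  reg a := by
    simp [Instr.exec, State.setReg, State.tick, Function.update_apply, Var.idx_inj, h.reg]
  mem := h.mem
  out := h.out
  time := congrArg (· + 1) h.time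
  cells := h.cells

theorem Describes.output (h : Describes w N A σ) (t : ℕ) :
    Describes w N { A with out := A.out ++ [σ.reg t], time := A.time + 1 }
      ((Instr.output t).exec w inp σ) where
  bounded := ⟨h.bounded.reg, h.bounded.work⟩
  wordSize := h.wordSize
  reg := h.reg
  mem := h.mem
  out := congrArg (· ++ [σ.reg t]) h.out
  time := congrArg (· + 1) h.time
  cells := h.cells

end Describes

/-- Code that evaluates an expression into register `t`, using registers from `t` on. -/
def Expr.code : Expr → ℕ → Program
  | const k, t => .instr (.const t k)
  | var a, t => .instr (.move t a.idx)
  | arith o a b, t => .seq (a.code t) (.seq (b.code (t + 1)) (.instr (.op o.toOp t t (t + 1))))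
  | input a, t => .seq (a.code t) (.instr (.readInput t t))

theorem Expr.code_runs (hinp : ∀ a, inp a < 2 ^ w) {N : ℕ} (e : Expr) {A : BState}
    (he : e.Fits w inp A.reg) {t : ℕ} (ht : 40 ≤ t) {σ : State} (hσ : Describes w N A σ) :
    ∃ τ, (e.code t).Runs w inp σ τ ∧ Describes w N { A with time := A.time + e.cost } τ ∧
      τ.reg t = e.val inp A.reg ∧ ∀ r < t, τ.reg r = σ.reg r := by
  have set_self (σ : State) (t x : ℕ) : (σ.setReg t x).tick.reg t = x := by
    simp [State.setReg, State.tick]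
  have set_of_lt (σ : State) (t x : ℕ) (r) (hr : r < t) : (σ.setReg t x).tick.reg r = σ.reg r := by
    simp [State.setReg, State.tick, hr.ne]
  induction e generalizing t A σ with
  | const k =>
    have hk : k % 2 ^ w = k := Nat.mod_eq_of_lt he
    exact ⟨_, .instr _ _, (hσ.setReg ht (hk.trans_lt he)).tick, (set_self ..).trans hk,
      set_of_lt σ t _⟩
  | var a =>
    exact ⟨_, .instr _ _, (hσ.setReg ht (hσ.bounded.reg _)).tick, (set_self ..).trans (hσ.reg a),
      set_of_lt σ t _⟩
  | arith o a b iha ihb =>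
    obtain ⟨ha, hb, hfit⟩ := he
    obtain ⟨σ₁, run₁, hσ₁, val₁, frame₁⟩ := iha ha ht hσ
    obtain ⟨σ₂, run₂, hσ₂, val₂, frame₂⟩ :=
      ihb (A := { A with time := A.time + a.cost }) hb (ht.trans t.le_succ) hσ₁
    have val₁' : σ₂.reg t = a.val inp A.reg := (frame₂ t t.lt_succ_self).trans val₁
    have hop : o.toOp.eval w (σ₂.reg t) (σ₂.reg (t + 1)) = (arith o a b).val inp A.reg := by
      rw [Arith.eval_toOp o (hσ₂.bounded.reg t) (by rwa [val₁', val₂]), val₁', val₂]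
      rfl
    have hlt := (hσ₂.bounded.exec hinp (.op o.toOp t t (t + 1))).reg t
    refine ⟨_, .seq run₁ (.seq run₂ (.instr _ _)), ?_, (set_self ..).trans hop, fun r hr => ?_⟩
    · simpa [cost, BState.tick, Instr.exec, add_assoc]
        using (hσ₂.setReg ht ((set_self ..).symm.trans_lt hlt)).tick
    · exact (set_of_lt σ₂ t _ r hr).trans ((frame₂ r (by omega)).trans (frame₁ r hr))
  | input a iha =>
    obtain ⟨σ₁, run₁, hσ₁, val₁, frame₁⟩ := iha he ht hσ
    exact ⟨_, .seq run₁ (.instr _ _), (hσ₁.setReg ht (hinp _)).tick,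
      (set_self ..).trans (congrArg inp val₁),
      fun r hr => (set_of_lt σ₁ t _ r hr).trans (frame₁ r hr)⟩

/-- Read into register `47` the field whose bit address is in register `40` and whose length is in
register `41`; registers `43`, `44` and `48` end up with the index of the second word involved,
the offset in the first word, and the number of bits from there to the end of that word. -/
def fetchCode : List Instr :=
  [.op .div 43 40 1, .op .mod 44 40 1, .load 45 43, .op .shr 45 45 44, .const 46 1,
    .op .add 43 43 46, .load 47 43, .op .sub 48 1 44, .op .shl 47 47 48, .op .or 45 45 47,
    .op .shl 46 46 41, .op .mod 47 45 46]

/-- After `fetchCode`, replace the field by the contents of register `42`. -/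
def replaceCode : List Instr :=
  [.op .xor 47 47 42, .op .shr 46 47 48, .load 45 43, .op .xor 45 45 46, .store 43 45,
    .op .div 43 40 1, .load 45 43, .op .shl 46 47 44, .op .xor 45 45 46, .store 43 45]

theorem bits_add_of_lt {work : ℕ → ℕ} {p i : ℕ} (h : p % w + i < w) :
    bits w work (p + i) = (work (p / w)).testBit (p % w + i) := by
  have hi : i % w = i := Nat.mod_eq_of_lt (by omega)
  rw [bits, Nat.add_div_eq_of_add_mod_lt (by rwa [hi]), Nat.add_mod_of_add_mod_lt (by rwa [hi]),
    hi, Nat.div_eq_of_lt (show i < w by omega), add_zero]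

theorem bits_add_of_le {work : ℕ → ℕ} {p i : ℕ} (hi : i < w) (h : w ≤ p % w + i) :
    bits w work (p + i) = (work (p / w + 1)).testBit (p % w + i - w) := by
  have hi' : i % w = i := Nat.mod_eq_of_lt hi
  have hmod := Nat.add_mod_add_of_le_add_mod (a := p) (by rwa [hi'])
  rw [bits, Nat.add_div_eq_of_le_mod_add_mod (by rwa [hi']) (by omega), Nat.div_eq_of_lt hi,
    add_zero, show (p + i) % w = p % w + i - w by omega]

theorem readBits_bits {work : ℕ → ℕ} (hwork : ∀ a, work a < 2 ^ w) {p f : ℕ} (hf : f < w) :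
    ((((work (p / w) >>> (p % w)) % 2 ^ w) ||| ((work (p / w + 1) <<< (w - p % w)) % 2 ^ w))
      % 2 ^ w) % 2 ^ f = readBits (bits w work) p f := by
  refine Nat.eq_of_testBit_eq fun i => ?_
  have hs : p % w < w := Nat.mod_lt _ (by omega)
  rw [testBit_readBits]
  by_cases hi : i < f
  · have hiw : i < w := hi.trans hf
    simp only [Nat.testBit_mod_two_pow, Nat.testBit_or, Nat.testBit_shiftRight,
      Nat.testBit_shiftLeft, hi, hiw, decide_true, Bool.true_and]
    rcases lt_or_ge (p % w + i) w with h | h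
    · simp [bits_add_of_lt h, show ¬ w - p % w ≤ i by omega]
    · have hfirst : (work (p / w)).testBit (p % w + i) = false :=
        Nat.testBit_eq_false_of_lt ((hwork _).trans_le (Nat.pow_le_pow_right two_pos h))
      simp [bits_add_of_le hiw h, hfirst, show w - p % w ≤ i by omega,
        show i - (w - p % w) = p % w + i - w by omega]
  · simp [hi]

theorem bits_update_xor {work : ℕ → ℕ} {p d : ℕ} (hw : 0 < w) (hd : d < 2 ^ w) :
    bits w (Function.update (Function.update work (p / w + 1)
        ((work (p / w + 1) ^^^ (d >>> (w - p % w) % 2 ^ w)) % 2 ^ w)) (p / w)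
        ((work (p / w) ^^^ (d <<< (p % w) % 2 ^ w)) % 2 ^ w)) =
      fun q => (bits w work q ^^ (decide (p ≤ q) && d.testBit (q - p))) := by
  funext q
  have hs : p % w < w := Nat.mod_lt p hw
  have hqs : q % w < w := Nat.mod_lt q hw
  have hp := Nat.div_add_mod p w
  have hq := Nat.div_add_mod q w
  by_cases h₁ : q / w = p / w
  · rw [h₁] at hq
    have hle : p % w ≤ q % w ↔ p ≤ q := by omega
    simp [bits, h₁, Nat.testBit_mod_two_pow, hqs, hle, show q % w - p % w = q - p by omega]
  by_cases h₂ : q / w = p / w + 1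
  · rw [h₂, mul_add, mul_one] at hq
    simp [bits, h₂, Nat.testBit_mod_two_pow, Nat.testBit_shiftRight, hqs,
      show w - p % w + q % w = q - p by omega, show p ≤ q by omega]
  · simp only [bits, Function.update_of_ne h₁, Function.update_of_ne h₂]
    rcases lt_or_gt_of_ne h₁ with h | h
    · have hlt : q < p := lt_of_not_ge fun hpq => h.not_ge (Nat.div_le_div_right hpq)
      simp [hlt.not_ge]
    · have hfar : w * (p / w + 2) ≤ w * (q / w) := Nat.mul_le_mul_left w (by omega)
      rw [Nat.testBit_eq_false_of_lt (hd.trans_le (Nat.pow_le_pow_right two_pos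
        (show w ≤ q - p by rw [mul_add] at hfar; omega)))]
      simp

attribute [local simp] execList Instr.exec State.setReg State.tick State.touch Op.eval in
theorem fetchCode_exec {σ : State} (hb : Bounded w σ) (hw : σ.reg 1 = w)
    {p f : ℕ} (hp : σ.reg 40 = p) (hf : σ.reg 41 = f) (hfw : f < w) (hpw : p / w + 1 < 2 ^ w) :
    ∃ τ, (block fetchCode).Runs w inp σ τ ∧ τ.reg 47 = readBits (bits w σ.work) p f ∧
      τ.reg 43 = p / w + 1 ∧ τ.reg 44 = p % w ∧ τ.reg 48 = w - p % w ∧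
      (∀ r < 43, τ.reg r = σ.reg r) ∧ τ.work = σ.work ∧ τ.out = σ.out ∧
      τ.time = σ.time + 12 ∧ τ.cells = max σ.cells (p / w + 2) := by
  have hs : p % w < w := Nat.mod_lt _ (by omega)
  have hww : w < 2 ^ w := Nat.lt_two_pow_self
  have h1 : 1 % 2 ^ w = 1 := Nat.mod_eq_of_lt (by omega)
  have hd : p / w % 2 ^ w = p / w := Nat.mod_eq_of_lt (by omega)
  have hm : p % w % 2 ^ w = p % w := Nat.mod_eq_of_lt (by omega)
  have hd1 : (p / w + 1) % 2 ^ w = p / w + 1 := Nat.mod_eq_of_lt hpw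
  have hsub : (w + (2 ^ w - p % w)) % 2 ^ w = w - p % w := by
    rw [show w + (2 ^ w - p % w) = (w - p % w) + 2 ^ w by omega, Nat.add_mod_right,
      Nat.mod_eq_of_lt (by omega)]
  have hff : 2 ^ f < 2 ^ w := Nat.pow_lt_pow_right (by norm_num) hfw
  have hsh : 1 <<< f % 2 ^ w = 2 ^ f := by
    rw [Nat.shiftLeft_eq, one_mul, Nat.mod_eq_of_lt hff]
  refine ⟨_, runs_block fetchCode σ, ?_, ?_, ?_, ?_, fun r hr => ?_, rfl, rfl, rfl, ?_⟩
  · have hval : _ = readBits (bits w σ.work) p f := readBits_bits hb.work hfw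
    simp only [fetchCode, execList, Instr.exec, State.setReg, State.tick, State.touch, Op.eval,
      Function.update_apply, hp, hf, hw, hd, hm, h1, hd1, hsub, hsh, reduceIte,
      Nat.reduceEqDiff, OfNat.one_ne_ofNat]
    rw [hval, Nat.mod_eq_of_lt ((readBits_lt _ _ _).trans hff)]
  · simp [fetchCode, hp, hw, hd, h1, hd1]
  · simp [fetchCode, hp, hw, hm]
  · simp [fetchCode, hp, hw, hm, hsub]
  · have hne (k) (hk : 43 ≤ k) : r ≠ k := (hr.trans_le hk).ne
    simp [fetchCode, hne]
  · simp [fetchCode, hp, hw, hd, h1, hd1, max_assoc]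

attribute [local simp] execList Instr.exec State.setReg State.tick State.touch Op.eval in
theorem replaceCode_exec {σ : State} (hb : Bounded w σ) (hw : σ.reg 1 = w) {p f x : ℕ}
    (hp : σ.reg 40 = p) (hx : σ.reg 42 = x) (hfw : f < w) (hxf : x < 2 ^ f)
    (hpw : p / w + 1 < 2 ^ w) (h47 : σ.reg 47 = readBits (bits w σ.work) p f)
    (h43 : σ.reg 43 = p / w + 1) (h44 : σ.reg 44 = p % w) (h48 : σ.reg 48 = w - p % w) :
    ∃ τ, (block replaceCode).Runs w inp σ τ ∧ bits w τ.work = writeBits (bits w σ.work) p f x ∧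
      (∀ r < 43, τ.reg r = σ.reg r) ∧ τ.out = σ.out ∧
      τ.time = σ.time + 10 ∧ τ.cells = max σ.cells (p / w + 2) := by
  have hd : p / w % 2 ^ w = p / w := Nat.mod_eq_of_lt (by omega)
  have hxor : readBits (bits w σ.work) p f ^^^ x < 2 ^ w :=
    Nat.xor_lt_two_pow (h47 ▸ hb.reg 47) (hx ▸ hb.reg 42)
  refine ⟨_, runs_block replaceCode σ, ?_, fun r hr => ?_, rfl, rfl, ?_⟩
  · rw [funext (writeBits_eq_xor (bits w σ.work) p hxf), ← bits_update_xor (by omega) hxor]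
    simp [replaceCode, hp, hx, hw, h47, h43, h44, h48, hd, Nat.mod_eq_of_lt hxor]
  · have hne (k) (hk : 43 ≤ k) : r ≠ k := (hr.trans_le hk).ne
    simp [replaceCode, hne]
  · simp [replaceCode, hp, hw, h43, hd]

/-- The word RAM program that implements a command. -/
def Cmd.code : Cmd → Program
  | skip => .skip
  | set d e => .seq (e.code 40) (.instr (.move d.idx 40))
  | out e => .seq (e.code 40) (.instr (.output 40))
  | rd d a f =>
      .seq (a.code 40) (.seq (f.code 41) (.seq (block fetchCode) (.instr (.move d.idx 47))))
  | wr a f s =>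
      .seq (a.code 40) (.seq (f.code 41) (.seq (s.code 42)
        (.seq (block fetchCode) (block replaceCode))))
  | seq c₁ c₂ => .seq c₁.code c₂.code
  | ite b c₁ c₂ => .ite b.toTest c₁.code c₂.code
  | loop b c => .loop b.toTest c.code

section Commands

variable {N : ℕ} {Q : BState → Prop} {A : BState} {σ : State}

theorem Cmd.loop_code_runs {b : Cond} {c : Cmd}
    (ih : ∀ {R : BState → Prop} {A : BState} {σ : State}, Describes w N A σ → c.wp w inp N R A →
      ∃ τ B, c.code.Runs w inp σ τ ∧ Describes w N B τ ∧ R B)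
    (hσ : Describes w N A σ) (h : LoopWP b (c.wp w inp N) Q A) :
    ∃ τ B, (loop b c).code.Runs w inp σ τ ∧ Describes w N B τ ∧ Q B := by
  induction h generalizing σ with
  | @done A hb hA =>
    exact ⟨_, _, .loop_false (mt (hσ.holds_iff b).1 hb), hσ.tick, hA⟩
  | @step A R hb hR _ ih' =>
    obtain ⟨τ, B, run, hB, hRB⟩ := ih hσ.tick hR
    obtain ⟨υ, C, run', hC, hQ⟩ := ih' B hRB hB
    exact ⟨υ, C, .loop_true ((hσ.holds_iff b).2 hb) run run', hC, hQ⟩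

variable (hinp : ∀ a, inp a < 2 ^ w)

include hinp

theorem Describes.fetch (hN : N + 1 < 2 ^ w) (hσ : Describes w N A σ) {p f : ℕ} (hpN : p ≤ N)
    (hfw : f < w) (hp : σ.reg 40 = p) (hf : σ.reg 41 = f) :
    ∃ τ, (block fetchCode).Runs w inp σ τ ∧ Describes w N { A with time := A.time + 12 } τ ∧
      τ.reg 47 = readBits A.mem p f ∧ τ.reg 43 = p / w + 1 ∧ τ.reg 44 = p % w ∧
      τ.reg 48 = w - p % w ∧ ∀ r < 43, τ.reg r = σ.reg r := by
  have hdiv : p / w ≤ N / w := Nat.div_le_div_right hpN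
  have hdiv' : N / w ≤ N := Nat.div_le_self _ _
  obtain ⟨τ, run, h47, h43, h44, h48, frame, work, out, time, cells⟩ :=
    fetchCode_exec (inp := inp) hσ.bounded hσ.wordSize hp hf hfw (by omega)
  refine ⟨τ, run, ?_, hσ.mem ▸ h47, h43, h44, h48, frame⟩
  exact {
    bounded := hσ.bounded.runs hinp run
    wordSize := (frame 1 (by norm_num)).trans hσ.wordSize
    reg := fun a => (frame _ (a.idx_lt.trans (by norm_num))).trans (hσ.reg a)
    mem := by rw [work, hσ.mem]
    out := out.trans hσ.out
    time := by rw [time, hσ.time]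
    cells := by have := hσ.cells; omega }

theorem Describes.replace (hN : N + 1 < 2 ^ w) (hσ : Describes w N A σ) {p f x : ℕ}
    (hpN : p ≤ N) (hfw : f < w) (hxf : x < 2 ^ f) (hp : σ.reg 40 = p) (hx : σ.reg 42 = x)
    (h47 : σ.reg 47 = readBits A.mem p f) (h43 : σ.reg 43 = p / w + 1) (h44 : σ.reg 44 = p % w)
    (h48 : σ.reg 48 = w - p % w) :
    ∃ τ, (block replaceCode).Runs w inp σ τ ∧
      Describes w N { A with mem := writeBits A.mem p f x, time := A.time + 10 } τ := by
  have hdiv : p / w ≤ N / w := Nat.div_le_div_right hpN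
  have hdiv' : N / w ≤ N := Nat.div_le_self _ _
  obtain ⟨τ, run, mem, frame, out, time, cells⟩ :=
    replaceCode_exec (inp := inp) hσ.bounded hσ.wordSize hp hx hfw hxf (by omega)
      (by rw [h47, hσ.mem]) h43 h44 h48
  exact ⟨τ, run, {
    bounded := hσ.bounded.runs hinp run
    wordSize := (frame 1 (by norm_num)).trans hσ.wordSize
    reg := fun a => (frame _ (a.idx_lt.trans (by norm_num))).trans (hσ.reg a)
    mem := by rw [mem, hσ.mem]
    out := out.trans hσ.out
    time := by rw [time, hσ.time]
    cells := by have := hσ.cells; omega }⟩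

theorem Cmd.rd_code_runs (hN : N + 1 < 2 ^ w) (hσ : Describes w N A σ) {d : Var} {a f : Expr}
    (h : (rd d a f).wp w inp N Q A) :
    ∃ τ B, (rd d a f).code.Runs w inp σ τ ∧ Describes w N B τ ∧ Q B := by
  obtain ⟨ha, hf, haN, hfw, hQ⟩ := h
  obtain ⟨σ₁, run₁, hσ₁, val₁, -⟩ := a.code_runs hinp ha le_rfl hσ
  obtain ⟨σ₂, run₂, hσ₂, val₂, frame₂⟩ :=
    f.code_runs hinp (A := { A with time := A.time + a.cost }) hf (t := 41) (by norm_num) hσ₁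
  obtain ⟨σ₃, run₃, hσ₃, val₃, -⟩ :=
    hσ₂.fetch hinp hN haN hfw ((frame₂ 40 (by norm_num)).trans val₁) val₂
  exact ⟨_, _, .seq run₁ (.seq run₂ (.seq run₃ (.instr _ _))), val₃ ▸ hσ₃.move d 47, hQ⟩

theorem Cmd.wr_code_runs (hN : N + 1 < 2 ^ w) (hσ : Describes w N A σ) {a f s : Expr}
    (h : (wr a f s).wp w inp N Q A) :
    ∃ τ B, (wr a f s).code.Runs w inp σ τ ∧ Describes w N B τ ∧ Q B := by
  obtain ⟨ha, hf, hs, haN, hfw, hsf, hQ⟩ := h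
  obtain ⟨σ₁, run₁, hσ₁, val₁, -⟩ := a.code_runs hinp ha le_rfl hσ
  obtain ⟨σ₂, run₂, hσ₂, val₂, frame₂⟩ :=
    f.code_runs hinp (A := { A with time := A.time + a.cost }) hf (t := 41) (by norm_num) hσ₁
  obtain ⟨σ₃, run₃, hσ₃, val₃, frame₃⟩ :=
    s.code_runs hinp (A := { A with time := A.time + a.cost + f.cost }) hs (t := 42) (by norm_num)
      hσ₂
  have address : σ₃.reg 40 = a.val inp A.reg := by
    rw [frame₃ 40 (by norm_num), frame₂ 40 (by norm_num), val₁]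
  obtain ⟨σ₄, run₄, hσ₄, h47, h43, h44, h48, frame₄⟩ :=
    hσ₃.fetch hinp hN haN hfw address ((frame₃ 41 (by norm_num)).trans val₂)
  obtain ⟨σ₅, run₅, hσ₅⟩ := hσ₄.replace hinp hN haN hfw hsf
    ((frame₄ 40 (by norm_num)).trans address) ((frame₄ 42 (by norm_num)).trans val₃)
    h47 h43 h44 h48
  exact ⟨_, _, .seq run₁ (.seq run₂ (.seq run₃ (.seq run₄ run₅))), hσ₅, hQ⟩

theorem Cmd.code_runs (hN : N + 1 < 2 ^ w) (c : Cmd) (hσ : Describes w N A σ)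
    (h : c.wp w inp N Q A) :
    ∃ τ B, c.code.Runs w inp σ τ ∧ Describes w N B τ ∧ Q B := by
  induction c generalizing Q A σ with
  | skip => exact ⟨σ, A, .skip σ, hσ, h⟩
  | set d e =>
    obtain ⟨τ, run, hτ, val, -⟩ := e.code_runs hinp h.1 le_rfl hσ
    exact ⟨_, _, .seq run (.instr _ _), val ▸ hτ.move d 40, h.2⟩
  | out e =>
    obtain ⟨τ, run, hτ, val, -⟩ := e.code_runs hinp h.1 le_rfl hσ
    exact ⟨_, _, .seq run (.instr _ _), val ▸ hτ.output 40, h.2⟩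
  | rd d a f => exact rd_code_runs hinp hN hσ h
  | wr a f s => exact wr_code_runs hinp hN hσ h
  | seq c₁ c₂ ih₁ ih₂ =>
    obtain ⟨τ, B, run, hB, hQ⟩ := ih₁ hσ h
    obtain ⟨υ, C, run', hC, hQ'⟩ := ih₂ hB hQ
    exact ⟨υ, C, .seq run run', hC, hQ'⟩
  | ite b c₁ c₂ ih₁ ih₂ =>
    by_cases hb : b.Holds A.reg
    · obtain ⟨τ, B, run, hB⟩ := ih₁ hσ.tick (h.1 hb)
      exact ⟨τ, B, .ite_true ((hσ.holds_iff b).2 hb) run, hB⟩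
    · obtain ⟨τ, B, run, hB⟩ := ih₂ hσ.tick (h.2 hb)
      exact ⟨τ, B, .ite_false (mt (hσ.holds_iff b).1 hb) run, hB⟩
  | loop b c ih => exact loop_code_runs (fun hσ h => ih hσ h) hσ h

end Commands

end Simulation

/-! ## The program -/

attribute [simp] Cmd.wp Cond.Holds BState.tick Expr.val Expr.Fits Expr.cost Arith.val Arith.Fits
  Expr.add_def Expr.sub_def Expr.mul_def Expr.mod_def

/-- `len := min deg ell` -/
def fieldLength : Cmd :=
  .set .len ◇.deg ;; .ite (.lt .ell .len) (.set .len ◇.ell) .skip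

/-- If the current depth `dep` is a multiple of `ell`, record the current vertex and the top of
the stack of positions. -/
def checkpoint : Cmd :=
  .set .lvl (◇.dep % ◇.ell) ;;
  .ite (.eq .lvl .zero)
    (.wr (◇.ck + ♯2 * ◇.dep) ◇.ell ◇.cur ;; .wr (◇.ck + ♯2 * ◇.dep + ◇.ell) ◇.ell ◇.top) .skip

/-- Make the window of buffered levels start at least at `dep - ell`. -/
def slide : Cmd :=
  .set .lvl (◇.lo + ◇.ell) ;; .ite (.lt .lvl .dep) (.set .lo (◇.lo + ♯1)) .skip

/-- Push the current vertex and the position `pos` in its list as the entry of level `dep`. -/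
def push : Cmd :=
  checkpoint ;;
  .wr (◇.num + ◇.dep % ◇.ell * ◇.ell) ◇.ell ◇.cur ;;
  fieldLength ;;
  .wr (◇.js + ◇.top) ◇.len ◇.pos ;;
  .set .top (◇.top + ◇.len) ;;
  .set .dep (◇.dep + ♯1) ;;
  slide

/-- Descend from the current vertex to `nbr`. -/
def descend : Cmd :=
  push ;;
  .wr ◇.nbr ♯1 ♯1 ;;
  .out ♯0 ;;
  .out ◇.nbr ;;
  .set .cur ◇.nbr ;;
  .set .pos ♯0

/-- Rewrite the buffer entry of level `lvl`, whose vertex is `nbr`, and move on to the next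
level. -/
def replay : Cmd :=
  .wr (◇.num + ◇.lvl % ◇.ell * ◇.ell) ◇.ell ◇.nbr ;;
  .set .deg (.input (.input ◇.nbr)) ;;
  fieldLength ;;
  .rd .pos (◇.js + ◇.off) ◇.len ;;
  .set .off (◇.off + ◇.len) ;;
  .set .nbr (.input (.input ◇.nbr + ♯1 + ◇.pos)) ;;
  .set .lvl (◇.lvl + ♯1)

/-- Rebuild the buffer from the last checkpoint below the current depth. -/
def restore : Cmd :=
  .set .lvl (◇.dep - ♯1) ;;
  .set .lvl (◇.lvl - ◇.lvl % ◇.ell) ;;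
  .set .lo ◇.lvl ;;
  .rd .nbr (◇.ck + ♯2 * ◇.lvl) ◇.ell ;;
  .rd .off (◇.ck + ♯2 * ◇.lvl + ◇.ell) ◇.ell ;;
  .loop (.lt .lvl .dep) replay

/-- Return from the current vertex to its parent, which is in the buffer. -/
def ascend : Cmd :=
  .set .dep (◇.dep - ♯1) ;;
  .rd .cur (◇.num + ◇.dep % ◇.ell * ◇.ell) ◇.ell ;;
  .set .deg (.input (.input ◇.cur)) ;;
  fieldLength ;;
  .set .top (◇.top - ◇.len) ;;
  .rd .pos (◇.js + ◇.top) ◇.len ;;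
  .set .pos (◇.pos + ♯1)

/-- One step of the search. -/
def searchStep : Cmd :=
  .set .deg (.input (.input ◇.cur)) ;;
  .ite (.lt .pos .deg)
    (.set .nbr (.input (.input ◇.cur + ♯1 + ◇.pos)) ;;
      .rd .col ◇.nbr ♯1 ;;
      .ite (.eq .col .zero) descend (.set .pos (◇.pos + ♯1)))
    (.out ♯1 ;;
      .out ◇.cur ;;
      .ite (.eq .dep .zero) (.set .flag ♯0)
        (.ite (.eq .dep .lo) restore .skip ;; ascend))

/-- Search from `root`. -/
def search : Cmd :=
  .wr ◇.root ♯1 ♯1 ;;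
  .out ♯0 ;;
  .out ◇.root ;;
  .set .cur ◇.root ;;
  .set .pos ♯0 ;;
  .set .flag ♯1 ;;
  .loop (.ne .flag .zero) searchStep

/-- Try `root` as a root and move on to the next vertex. -/
def rootStep : Cmd :=
  .rd .col ◇.root ♯1 ;; .ite (.eq .col .zero) search .skip ;; .set .root (◇.root + ♯1)

/-- Mark vertex `root` undiscovered and count its neighbours. -/
def clearStep : Cmd :=
  .wr ◇.root ♯1 ♯0 ;;
  .set .total (◇.total + .input (.input ◇.root)) ;;
  .set .root (◇.root + ♯1)

/-- Increment `ell`, keeping `pw = 2 ^ ell`. -/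
def lengthStep : Cmd :=
  .set .pw (◇.pw + ◇.pw) ;; .set .ell (◇.ell + ♯1)

/-- Clear the colours, make `ell` the bit length of the sum of `num` and all degrees, and lay out
the working memory: colours, buffer, checkpoints and stack of positions, in this order. -/
def setup : Cmd :=
  .set .total ◇.num ;;
  .loop (.lt .root .num) clearStep ;;
  .set .root ♯0 ;;
  .set .pw ♯1 ;;
  .loop (.le .pw .total) lengthStep ;;
  .set .ck (◇.num + ◇.ell * ◇.ell) ;;
  .set .js (◇.ck + (♯2 * ◇.num + ♯2 * ◇.ell))

/-- The depth-first search of the whole graph. -/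
def dfs : Cmd := setup ;; .loop (.lt .root .num) rootStep

/-! ## The search path and its representation -/

section Layout
variable {n : ℕ} (adj : Fin n → List (Fin n)) (ℓ : ℕ)

/-- The number of edges, undirected edges being counted twice. -/
def totalDegree : ℕ := ∑ u, (adj u).length

/-- The number of bits in which a position in the neighbour list of `u` is stored. -/
def slot (u : Fin n) : ℕ := min (adj u).length ℓ

/-- The number of bits in which the positions of a stack are stored. A stack lists the proper
ancestors of a vertex, the parent first, each with a position in its neighbour list. -/
def offset (st : List (Fin n × ℕ)) : ℕ := (st.map fun e => slot adj ℓ e.1).sum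

/-- The address of the table of checkpoints. It is preceded by the colours and by a cyclic buffer
of `ℓ` fields. -/
def ckBase (n ℓ : ℕ) : ℕ := n + ℓ * ℓ

/-- The address of the stack of positions. It is preceded by the table of checkpoints, in which the
entry of level `d` consists of two fields at `ckBase n ℓ + 2 * d` if `ℓ` divides `d`. -/
def jsBase (n ℓ : ℕ) : ℕ := ckBase n ℓ + (2 * n + 2 * ℓ)

/-- The input is an adjacency array, `ℓ` bits suffice for the numbers that are stored in fields,
and words suffice for the addresses of bits, the last one being `N`. -/
structure Sized (w N : ℕ) (inp : ℕ → ℕ) : Prop where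
  array : IsAdjacencyArray w adj inp
  ell_pos : 0 < ℓ
  total_lt : n + totalDegree adj < 2 ^ ℓ
  ell_lt : ℓ < w
  limit_eq : N = jsBase n ℓ + totalDegree adj
  limit_lt : N + 1 < 2 ^ w

/-- The vertex of each entry of the stack is followed, at the stored position of its neighbour
list, by the vertex of the preceding entry, or by `v` if the entry is the first one. -/
def IsPath : Fin n → List (Fin n × ℕ) → Prop
  | _, [] => True
  | v, e :: t => (adj e.1)[e.2]? = some v ∧ IsPath e.1 t

/-- The vertex `v` and the stack `st` form a path of distinct vertices of `S`, the set of
discovered vertices. -/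
structure SearchPath (S : Finset (Fin n)) (v : Fin n) (st : List (Fin n × ℕ)) : Prop where
  links : IsPath adj v st
  nodup : (v :: st.map Prod.fst).Nodup
  discovered : ∀ u ∈ v :: st.map Prod.fst, u ∈ S

/-- The memory contents that represent the entry `e` on top of the stack `t` when the levels from
`lo` up to `hi` are buffered. -/
structure EntryMem (M : ℕ → Bool) (lo hi : ℕ) (e : Fin n × ℕ) (t : List (Fin n × ℕ)) :
    Prop where
  pos : readBits M (jsBase n ℓ + offset adj ℓ t) (slot adj ℓ e.1) = e.2
  buf : lo ≤ t.length → t.length < hi → readBits M (n + t.length % ℓ * ℓ) ℓ = e.1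
  vertex : t.length % ℓ = 0 → readBits M (ckBase n ℓ + 2 * t.length) ℓ = e.1
  offset : t.length % ℓ = 0 →
    readBits M (ckBase n ℓ + 2 * t.length + ℓ) ℓ = offset adj ℓ t

/-- The memory contents that represent the stack `st` when the levels from `lo` up to `hi` are
buffered. -/
def StackMem (M : ℕ → Bool) (lo hi : ℕ) (st : List (Fin n × ℕ)) : Prop :=
  ∀ e t, e :: t <:+ st → EntryMem adj ℓ M lo hi e t

end Layout

section Path
variable {n : ℕ} {adj : Fin n → List (Fin n)} {ℓ : ℕ} {S : Finset (Fin n)} {u v : Fin n} {j : ℕ}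
  {e : Fin n × ℕ} {st t : List (Fin n × ℕ)}

theorem length_le_totalDegree (u : Fin n) : (adj u).length ≤ totalDegree adj :=
  Finset.single_le_sum (f := fun u => (adj u).length) (fun _ _ => Nat.zero_le _)
    (Finset.mem_univ u)

theorem slot_le (u : Fin n) : slot adj ℓ u ≤ ℓ := min_le_right _ _

theorem offset_cons (e : Fin n × ℕ) (t : List (Fin n × ℕ)) :
    offset adj ℓ (e :: t) = slot adj ℓ e.1 + offset adj ℓ t := by
  simp [offset]

theorem offset_le_of_suffix (h : t <:+ st) : offset adj ℓ t ≤ offset adj ℓ st :=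
  (h.sublist.map _).sum_le_sum fun _ _ => Nat.zero_le _

theorem offset_le_totalDegree (h : (st.map Prod.fst).Nodup) :
    offset adj ℓ st ≤ totalDegree adj :=
  calc offset adj ℓ st = ∑ u ∈ (st.map Prod.fst).toFinset, slot adj ℓ u := by
        rw [List.sum_toFinset _ h, offset, List.map_map]
        rfl
    _ ≤ ∑ u, slot adj ℓ u := Finset.sum_le_sum_of_subset (Finset.subset_univ _)
    _ ≤ totalDegree adj := Finset.sum_le_sum fun u _ => min_le_left _ _

theorem IsPath.of_suffix (h : IsPath adj v st) (he : e :: t <:+ st) : IsPath adj e.1 t := by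
  induction st generalizing v with
  | nil => simp at he
  | cons a st ih =>
    rcases List.suffix_cons_iff.1 he with heq | he
    · obtain ⟨rfl, rfl⟩ := List.cons.inj heq
      exact h.2
    · exact ih h.2 he

theorem IsPath.lt_length (h : IsPath adj v st) (he : e :: t <:+ st) :
    e.2 < (adj e.1).length := by
  induction st generalizing v with
  | nil => simp at he
  | cons a st ih =>
    rcases List.suffix_cons_iff.1 he with heq | he
    · obtain ⟨rfl, rfl⟩ := List.cons.inj heq
      exact (List.getElem?_eq_some_iff.1 h.1).1
    · exact ih h.2 he

theorem SearchPath.length_lt (h : SearchPath adj S v st) : st.length < n := by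
  simpa using h.nodup.length_le_card

theorem SearchPath.offset_le (h : SearchPath adj S v st) :
    offset adj ℓ st ≤ totalDegree adj :=
  offset_le_totalDegree (List.nodup_cons.1 h.nodup).2

theorem SearchPath.push (h : SearchPath adj S v st) (huv : (adj v)[j]? = some u) (hu : u ∉ S) :
    SearchPath adj (insert u S) u ((v, j) :: st) where
  links := ⟨huv, h.links⟩
  nodup := List.nodup_cons.2 ⟨fun hm => hu (h.discovered u hm), h.nodup⟩
  discovered := List.forall_mem_cons.2 ⟨Finset.mem_insert_self _ _,
    fun x hx => Finset.mem_insert_of_mem (h.discovered x hx)⟩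

theorem SearchPath.pop (h : SearchPath adj S v (e :: st)) : SearchPath adj S e.1 st where
  links := h.links.2
  nodup := (List.nodup_cons.1 h.nodup).2
  discovered x hx := h.discovered x (List.mem_cons_of_mem _ hx)

end Path

section StackMem
variable {n : ℕ} {adj : Fin n → List (Fin n)} {ℓ w N : ℕ} {inp : ℕ → ℕ}
  {M M' : ℕ → Bool} {lo hi lo' hi' : ℕ} {e : Fin n × ℕ} {st t : List (Fin n × ℕ)}

theorem Sized.bounds (hs : Sized adj ℓ w N inp) :
    0 < ℓ ∧ ℓ < w ∧ 2 < 2 ^ w ∧ n + totalDegree adj < 2 ^ ℓ ∧ ckBase n ℓ = n + ℓ * ℓ ∧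
      jsBase n ℓ = ckBase n ℓ + (2 * n + 2 * ℓ) ∧ N = jsBase n ℓ + totalDegree adj ∧
      N + 1 < 2 ^ w := by
  have h₁ := hs.ell_pos
  have h₂ := hs.ell_lt
  have : 2 ^ 2 ≤ 2 ^ w := Nat.pow_le_pow_right two_pos (by omega)
  exact ⟨h₁, h₂, by omega, hs.total_lt, rfl, rfl, hs.limit_eq, hs.limit_lt⟩

theorem Sized.lt_two_pow_slot (hs : Sized adj ℓ w N inp) {u : Fin n} {j : ℕ}
    (hj : j < (adj u).length) : j < 2 ^ slot adj ℓ u := by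
  have h₁ := length_le_totalDegree (adj := adj) u
  have h₂ := hs.total_lt
  unfold slot
  rcases le_total (adj u).length ℓ with h | h
  · rw [min_eq_left h]
    exact hj.trans Nat.lt_two_pow_self
  · rw [min_eq_right h]
    omega

theorem Sized.input_length (hs : Sized adj ℓ w N inp) (u : Fin n) :
    inp (inp u) = (adj u).length :=
  hs.array.length u

theorem Sized.input_neighbor (hs : Sized adj ℓ w N inp) {u v : Fin n} {j : ℕ}
    (h : (adj u)[j]? = some v) : inp (inp u + 1 + j) = v ∧ inp u + 1 + j < 2 ^ w := by
  obtain ⟨hj, rfl⟩ := List.getElem?_eq_some_iff.1 h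
  have := hs.array.fits u
  exact ⟨hs.array.neighbor u j hj, by omega⟩

theorem mod_mul_add_le (x : ℕ) (h : 0 < ℓ) : x % ℓ * ℓ + ℓ ≤ ℓ * ℓ := by
  have := Nat.mod_lt x h
  nlinarith

theorem mod_ne_of_lt {x y : ℕ} (h₁ : x < y) (h₂ : y < x + ℓ) : x % ℓ ≠ y % ℓ := by
  intro h
  have := Nat.le_of_dvd (by omega) ((Nat.modEq_iff_dvd' h₁.le).1 h)
  omega

theorem mod_mul_disjoint {x y : ℕ} (h : x % ℓ ≠ y % ℓ) :
    x % ℓ * ℓ + ℓ ≤ y % ℓ * ℓ ∨ y % ℓ * ℓ + ℓ ≤ x % ℓ * ℓ := by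
  rcases lt_or_gt_of_ne h with h | h
  · left; nlinarith
  · right; nlinarith

theorem EntryMem.congr (h : EntryMem adj ℓ M lo hi e t)
    (hpos : ∀ i < slot adj ℓ e.1,
      M' (jsBase n ℓ + WordRAM.offset adj ℓ t + i) = M (jsBase n ℓ + WordRAM.offset adj ℓ t + i))
    (hbuf : lo' ≤ t.length → t.length < hi' → lo ≤ t.length ∧ t.length < hi ∧
      ∀ i < ℓ, M' (n + t.length % ℓ * ℓ + i) = M (n + t.length % ℓ * ℓ + i))
    (hck : t.length % ℓ = 0 →
      ∀ i < 2 * ℓ, M' (ckBase n ℓ + 2 * t.length + i) = M (ckBase n ℓ + 2 * t.length + i)) :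
    EntryMem adj ℓ M' lo' hi' e t where
  pos := (readBits_congr hpos).trans h.pos
  buf h₁ h₂ := by
    obtain ⟨hlo, hhi, hM⟩ := hbuf h₁ h₂
    exact (readBits_congr hM).trans (h.buf hlo hhi)
  vertex h₁ := (readBits_congr fun i hi => hck h₁ i (by omega)).trans (h.vertex h₁)
  offset h₁ := (readBits_congr fun i hi => by
    simpa only [add_assoc] using hck h₁ (ℓ + i) (by omega)).trans (h.offset h₁)

theorem StackMem.nil : StackMem adj ℓ M lo hi [] := by
  intro e t he
  simp at he

theorem StackMem.congr (h : StackMem adj ℓ M lo hi st) (hM : ∀ q, n ≤ q → M' q = M q) :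
    StackMem adj ℓ M' lo hi st := fun e t he =>
  (h e t he).congr (fun _ _ => hM _ (by unfold jsBase ckBase; omega))
    (fun h₁ h₂ => ⟨h₁, h₂, fun _ _ => hM _ (by omega)⟩)
    (fun _ _ _ => hM _ (by unfold ckBase; omega))

theorem StackMem.of_suffix (h : StackMem adj ℓ M lo hi st) (ht : t <:+ st)
    (hwin : ∀ d, lo' ≤ d → d < hi' → lo ≤ d ∧ d < hi) : StackMem adj ℓ M lo' hi' t :=
  fun e s he => (h e s (he.trans ht)).congr (fun _ _ => rfl)
    (fun h₁ h₂ => ⟨(hwin _ h₁ h₂).1, (hwin _ h₁ h₂).2, fun _ _ => rfl⟩) (fun _ _ _ => rfl)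

/-- The bits outside the fields in which the entry of level `d` on top of a stack of `o` bits is
stored. -/
def OutsideEntry (n ℓ d o q : ℕ) : Prop :=
  (q < n + d % ℓ * ℓ ∨ n + d % ℓ * ℓ + ℓ ≤ q) ∧
  (d % ℓ = 0 → q < ckBase n ℓ + 2 * d ∨ ckBase n ℓ + 2 * d + 2 * ℓ ≤ q) ∧
  q < jsBase n ℓ + o

theorem StackMem.push (hs : Sized adj ℓ w N inp) (h : StackMem adj ℓ M lo st.length st)
    (hn : st.length < n) (hlo : lo ≤ lo') (hhi : st.length < lo' + ℓ)
    (htop : EntryMem adj ℓ M' lo' (st.length + 1) e st)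
    (hM : ∀ q, OutsideEntry n ℓ st.length (offset adj ℓ st) q → M' q = M q) :
    StackMem adj ℓ M' lo' (st.length + 1) (e :: st) := by
  have hB := hs.bounds
  have hd := mod_mul_add_le st.length hs.ell_pos
  intro e' t he
  rcases List.suffix_cons_iff.1 he with heq | he
  · obtain ⟨rfl, rfl⟩ := List.cons.inj heq
    exact htop
  have hlen : t.length < st.length := he.length_le
  have hoff := offset_le_of_suffix (adj := adj) (ℓ := ℓ) he
  rw [offset_cons] at hoff
  have hb := mod_mul_add_le t.length hs.ell_pos
  refine (h e' t he).congr (fun i hi => hM _ ⟨by omega, by omega, by omega⟩)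
    (fun h₁ _ => ⟨by omega, hlen, fun i hi => hM _ ?_⟩) fun h₁ i hi => hM _ ?_
  · have := mod_mul_disjoint (mod_ne_of_lt (ℓ := ℓ) hlen (by omega))
    exact ⟨by omega, by omega, by omega⟩
  · refine ⟨by omega, fun h₂ => ?_, by omega⟩
    have : t.length + ℓ ≤ st.length :=
      not_lt.1 fun h' => mod_ne_of_lt hlen h' (h₁.trans h₂.symm)
    omega

theorem StackMem.rebuffer (hs : Sized adj ℓ w N inp) (h : StackMem adj ℓ M lo t.length st)
    (he : e :: t <:+ st) (hlo : t.length < lo + ℓ) :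
    StackMem adj ℓ (writeBits M (n + t.length % ℓ * ℓ) ℓ e.1) lo (t.length + 1) st := by
  have hB := hs.bounds
  have hd := mod_mul_add_le t.length hs.ell_pos
  intro e' t' he'
  have hold := h e' t' he'
  refine ⟨(readBits_writeBits_of_disjoint (by omega)).trans hold.pos, fun h₁ h₂ => ?_,
    fun h₁ => (readBits_writeBits_of_disjoint (by omega)).trans (hold.vertex h₁),
    fun h₁ => (readBits_writeBits_of_disjoint (by omega)).trans (hold.offset h₁)⟩
  by_cases hl : t'.length = t.length
  · have heq : e' :: t' = e :: t :=
      (List.suffix_of_suffix_length_le he' he (by simp [hl])).eq_of_length (by simp [hl])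
    obtain ⟨rfl, rfl⟩ := List.cons.inj heq
    exact readBits_writeBits_self (by omega)
  · have := mod_mul_disjoint (mod_ne_of_lt (ℓ := ℓ) (x := t'.length) (y := t.length)
      (by omega) (by omega))
    exact (readBits_writeBits_of_disjoint (by omega)).trans (hold.buf h₁ (by omega))

end StackMem

/-! ## Correctness of the parts of a search step -/

section Invariants
variable {n : ℕ} (adj : Fin n → List (Fin n)) (ℓ : ℕ)

/-- The variables that are not changed during a search have their values, where `r` is the root,
and the colours represent the set `S` of discovered vertices. -/
structure Ready (r : ℕ) (S : Finset (Fin n)) (ρ : Var → ℕ) (M : ℕ → Bool) : Prop where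
  num : ρ .num = n
  ell : ρ .ell = ℓ
  ck : ρ .ck = ckBase n ℓ
  js : ρ .js = jsBase n ℓ
  zero : ρ .zero = 0
  root : ρ .root = r
  color : ∀ u : Fin n, M u = decide (u ∈ S)

/-- The variables and the memory when the search is at the vertex `v` with the stack `st`. At most
`ℓ` levels are buffered, namely those from `lo` up to the current depth. -/
structure OnPath (r : ℕ) (v : Fin n) (st : List (Fin n × ℕ)) (S : Finset (Fin n)) (ρ : Var → ℕ)
    (M : ℕ → Bool) : Prop extends Ready ℓ r S ρ M where
  cur : ρ .cur = v
  dep : ρ .dep = st.length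
  lo_le : ρ .lo ≤ st.length
  le_lo : st.length ≤ ρ .lo + ℓ
  top : ρ .top = offset adj ℓ st
  flag : ρ .flag = 1
  path : SearchPath adj S v st
  stack : StackMem adj ℓ M (ρ .lo) st.length st

/-- The variables and the memory when the search is at the vertex `v` with the stack `st` and has
scanned the first `j` neighbours of `v`. -/
structure Active (r : ℕ) (v : Fin n) (j : ℕ) (st : List (Fin n × ℕ)) (S : Finset (Fin n))
    (ρ : Var → ℕ) (M : ℕ → Bool) : Prop extends OnPath adj ℓ r v st S ρ M where
  pos : ρ .pos = j
  pos_le : j ≤ (adj v).length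

/-- The time used plus `100` steps for each level that is missing in the buffer: refilling the
buffer is paid for by the descents and ascents that used it up. -/
def potential (A : BState) : ℕ := A.time + 100 * (ℓ + A.reg .lo - A.reg .dep)

end Invariants

section Parts
variable {n : ℕ} {adj : Fin n → List (Fin n)} {ℓ w N r : ℕ} {inp : ℕ → ℕ} {Q : BState → Prop}
  {A : BState} {u v : Fin n} {j : ℕ} {e : Fin n × ℕ} {st t : List (Fin n × ℕ)}
  {S : Finset (Fin n)} {ρ ρ' : Var → ℕ} {M : ℕ → Bool}

theorem Ready.congr (h : Ready ℓ r S ρ M)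
    (hρ : ∀ x ∈ [Var.num, .ell, .ck, .js, .zero, .root], ρ' x = ρ x) : Ready ℓ r S ρ' M where
  num := (hρ _ (by simp)).trans h.num
  ell := (hρ _ (by simp)).trans h.ell
  ck := (hρ _ (by simp)).trans h.ck
  js := (hρ _ (by simp)).trans h.js
  zero := (hρ _ (by simp)).trans h.zero
  root := (hρ _ (by simp)).trans h.root
  color := h.color

theorem Ready.of_mem_eq {M' : ℕ → Bool} (h : Ready ℓ r S ρ M) (hM : ∀ q < n, M' q = M q) :
    Ready ℓ r S ρ M' :=
  { h with color := fun x => (hM x x.2).trans (h.color x) }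

theorem Ready.insert (h : Ready ℓ r S ρ M) (u : Fin n) :
    Ready ℓ r (insert u S) ρ (writeBits M u 1 1) where
  __ := h
  color x := by
    by_cases hx : x = u
    · subst hx
      simp [writeBits]
    · have : (x : ℕ) ≠ u := fun h' => hx (Fin.ext h')
      rw [writeBits_of_outside (by omega), h.color]
      simp [hx]

theorem OnPath.congr (h : OnPath adj ℓ r v st S ρ M)
    (hρ : ∀ x ∈ [Var.num, .ell, .ck, .js, .zero, .root, .cur, .dep, .lo, .top, .flag],
      ρ' x = ρ x) : OnPath adj ℓ r v st S ρ' M := by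
  have hlo : ρ' .lo = ρ .lo := hρ _ (by simp)
  exact
  { toReady := h.toReady.congr fun x hx => hρ x (by aesop)
    cur := (hρ _ (by simp)).trans h.cur
    dep := (hρ _ (by simp)).trans h.dep
    lo_le := hlo ▸ h.lo_le
    le_lo := hlo ▸ h.le_lo
    top := (hρ _ (by simp)).trans h.top
    flag := (hρ _ (by simp)).trans h.flag
    path := h.path
    stack := hlo ▸ h.stack }

theorem wp_fieldLength
    (h : ∀ t, t ≤ A.time + 5 → Q { A with
      reg := Function.update A.reg .len (min (A.reg .deg) (A.reg .ell)), time := t }) :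
    fieldLength.wp w inp N Q A := by
  by_cases hd : A.reg .ell < A.reg .deg
  · simpa [fieldLength, hd, hd.le] using h (A.time + 5) le_rfl
  · simpa [fieldLength, hd, not_lt.1 hd] using h (A.time + 3) (by omega)

theorem wp_slide (hw : A.reg .lo + A.reg .ell + 1 < 2 ^ w)
    (hle : A.reg .dep ≤ A.reg .lo + A.reg .ell + 1) (he : 0 < A.reg .ell)
    (h : ∀ t x, t ≤ A.time + 9 → Q { A with
      reg := Function.update (Function.update A.reg .lvl x) .lo
        (max (A.reg .lo) (A.reg .dep - A.reg .ell)), time := t }) :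
    slide.wp w inp N Q A := by
  by_cases hd : A.reg .lo + A.reg .ell < A.reg .dep
  · have hmax : max (A.reg .lo) (A.reg .dep - A.reg .ell) = A.reg .lo + 1 := by omega
    simpa [slide, hd, show A.reg .lo + A.reg .ell < 2 ^ w by omega,
      show A.reg .lo + 1 < 2 ^ w by omega, show 1 < 2 ^ w by omega, hmax]
      using h (A.time + 9) (A.reg .lo + A.reg .ell) le_rfl
  · have hmax : max (A.reg .lo) (A.reg .dep - A.reg .ell) = A.reg .lo := by omega
    have hlo : Function.update (Function.update A.reg Var.lvl (A.reg .lo + A.reg .ell)) Var.lo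
        (A.reg .lo) = Function.update A.reg Var.lvl (A.reg .lo + A.reg .ell) := by
      simp [Function.update_eq_self_iff]
    simpa [slide, hd, show A.reg .lo + A.reg .ell < 2 ^ w by omega, hmax, hlo]
      using h (A.time + 5) (A.reg .lo + A.reg .ell) (by omega)

theorem wp_checkpoint (hs : Sized adj ℓ w N inp) (hA : OnPath adj ℓ r v st S A.reg A.mem)
    (h : ∀ t x M, t ≤ A.time + 100 →
      (st.length % ℓ = 0 →
        readBits M (ckBase n ℓ + 2 * st.length) ℓ = v ∧
        readBits M (ckBase n ℓ + 2 * st.length + ℓ) ℓ = offset adj ℓ st) →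
      (∀ q, (st.length % ℓ = 0 →
          q < ckBase n ℓ + 2 * st.length ∨ ckBase n ℓ + 2 * st.length + 2 * ℓ ≤ q) →
        M q = A.mem q) →
      Q { A with reg := Function.update A.reg .lvl x, mem := M, time := t }) :
    checkpoint.wp w inp N Q A := by
  have hB := hs.bounds
  have hlen := hA.path.length_lt
  have hoff := hA.path.offset_le (ℓ := ℓ)
  simp only [checkpoint, Cmd.wp, Expr.Fits, Expr.val, Arith.Fits, Arith.val, Expr.add_def,
    Expr.mul_def, Expr.mod_def, Cond.Holds, BState.tick, Function.update_apply, reduceCtorEq,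
    ↓reduceIte, hA.dep, hA.ell, hA.ck, hA.zero, hA.cur, hA.top, true_and]
  refine ⟨fun hd => ⟨by omega, by omega, by omega, by omega, by omega, by omega, by omega,
    by omega, ?_⟩, fun hd => h _ _ _ (by simp) (fun h' => absurd h' hd) fun _ _ => rfl⟩
  refine h _ _ _ ?_ (fun _ => ⟨?_, ?_⟩) fun q hq => ?_
  · simp
  · rw [readBits_writeBits_of_disjoint (by omega), readBits_writeBits_self (by omega)]
  · exact readBits_writeBits_self (by omega)
  · have := hq hd
    rw [writeBits_of_outside (by omega), writeBits_of_outside (by omega)]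

theorem StackMem.push_writeBits (hs : Sized adj ℓ w N inp) {M M' : ℕ → Bool} {lo : ℕ}
    (h : StackMem adj ℓ M lo st.length st) (hn : st.length < n) (hj : j < (adj v).length)
    (hck : st.length % ℓ = 0 →
      readBits M' (ckBase n ℓ + 2 * st.length) ℓ = v ∧
      readBits M' (ckBase n ℓ + 2 * st.length + ℓ) ℓ = offset adj ℓ st)
    (hM : ∀ q, (st.length % ℓ = 0 →
        q < ckBase n ℓ + 2 * st.length ∨ ckBase n ℓ + 2 * st.length + 2 * ℓ ≤ q) → M' q = M q) :
    StackMem adj ℓ (writeBits (writeBits M' (n + st.length % ℓ * ℓ) ℓ v)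
        (jsBase n ℓ + offset adj ℓ st) (slot adj ℓ v) j)
      (max lo (st.length + 1 - ℓ)) (st.length + 1) ((v, j) :: st) := by
  have hB := hs.bounds
  have hd := mod_mul_add_le st.length hs.ell_pos
  refine h.push hs hn (le_max_left _ _) (by omega)
    ⟨readBits_writeBits_self (hs.lt_two_pow_slot hj), fun _ _ => ?_, fun h₁ => ?_, fun h₁ => ?_⟩
    fun q ⟨hbuf, hcp, hpos⟩ => ?_
  · rw [readBits_writeBits_of_disjoint (by omega), readBits_writeBits_self (by omega)]
  · rw [readBits_writeBits_of_disjoint (by omega), readBits_writeBits_of_disjoint (by omega),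
      (hck h₁).1]
  · rw [readBits_writeBits_of_disjoint (by omega), readBits_writeBits_of_disjoint (by omega),
      (hck h₁).2]
  · rw [writeBits_of_outside (by omega), writeBits_of_outside (by omega), hM q hcp]

theorem wp_push (hs : Sized adj ℓ w N inp) (hA : Active adj ℓ r v j st S A.reg A.mem)
    (hdeg : A.reg .deg = (adj v).length) (hj : j < (adj v).length)
    (hoff : offset adj ℓ ((v, j) :: st) ≤ totalDegree adj)
    (h : ∀ B, Ready ℓ r S B.reg B.mem → B.reg .dep = st.length + 1 →
      B.reg .lo = max (A.reg .lo) (st.length + 1 - ℓ) →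
      B.reg .top = offset adj ℓ ((v, j) :: st) → B.reg .flag = 1 → B.reg .nbr = A.reg .nbr →
      StackMem adj ℓ B.mem (B.reg .lo) (st.length + 1) ((v, j) :: st) →
      B.out = A.out → B.time ≤ A.time + 180 → Q B) :
    push.wp w inp N Q A := by
  have hB := hs.bounds
  have hb := mod_mul_add_le st.length hs.ell_pos
  have hlen := hA.path.length_lt
  have hle := hA.le_lo
  have hlo := hA.lo_le
  have hslot := slot_le (adj := adj) (ℓ := ℓ) v
  have hmin : min (adj v).length ℓ = slot adj ℓ v := rfl
  rw [offset_cons] at hoff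
  simp only [push, Cmd.wp]
  refine wp_checkpoint hs hA.toOnPath fun t₁ x₁ M₁ ht₁ hck hM => ?_
  simp only [Expr.Fits, Expr.val, Arith.Fits, Arith.val, Expr.add_def, Expr.mul_def,
    Expr.mod_def, Function.update_apply, reduceCtorEq, ↓reduceIte, hA.num, hA.dep, hA.ell, hA.cur,
    true_and]
  refine ⟨⟨by omega, by omega⟩, by omega, by omega, by omega, wp_fieldLength fun t₂ ht₂ => ?_⟩
  simp only [Function.update_apply, reduceCtorEq, ↓reduceIte, hA.js, hA.top, hdeg, hA.ell, hA.pos,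
    hA.dep, hmin]
  refine ⟨by omega, by omega, by omega, hs.lt_two_pow_slot hj, by omega, ⟨by omega, by omega⟩,
    wp_slide ?_ ?_ ?_ fun t₃ x₃ ht₃ => h _ ?_ ?_ ?_ ?_ ?_ ?_ ?_ rfl ?_⟩
  · simp [hA.ell]; omega
  · simp [hA.ell]; omega
  · simp [hA.ell]; omega
  · refine (hA.toReady.of_mem_eq fun q hq => ?_).congr (by simp)
    dsimp only
    rw [writeBits_of_outside (by omega), writeBits_of_outside (by omega), hM q (by omega)]
  · simp
  · simp [hA.ell]
  · simp [offset_cons, add_comm]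
  · simpa using hA.flag
  · simp
  · simpa [hA.ell] using hA.stack.push_writeBits hs hlen hj hck hM
  · simp only [Expr.cost] at ht₁ ht₂ ht₃ ⊢
    omega

theorem wp_descend (hs : Sized adj ℓ w N inp) (hA : Active adj ℓ r v j st S A.reg A.mem)
    (hdeg : A.reg .deg = (adj v).length) (hnbr : A.reg .nbr = u)
    (huv : (adj v)[j]? = some u) (hu : u ∉ S)
    (h : ∀ B, Active adj ℓ r u 0 ((v, j) :: st) (insert u S) B.reg B.mem →
      B.out = A.out ++ [0, (u : ℕ)] → potential ℓ B ≤ potential ℓ A + 300 → Q B) :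
    descend.wp w inp N Q A := by
  have hbounds := hs.bounds
  have hpush := hA.path.push huv hu
  have hle := hA.le_lo
  have hlo := hA.lo_le
  simp only [descend, Cmd.wp]
  refine wp_push hs hA hdeg (List.getElem?_eq_some_iff.1 huv).1 hpush.offset_le
    fun B hB hdep hlo' htop hflag hnbr' hstack hout htime => ?_
  rw [hnbr] at hnbr'
  simp only [Expr.Fits, Expr.val, hnbr', true_and]
  refine ⟨by omega, by omega, by omega, by omega, by norm_num, by omega, by omega, h _ ?_ ?_ ?_⟩
  · exact
    { toReady := (hB.insert u).congr (by simp)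
      cur := by simp
      dep := by simpa using hdep
      lo_le := by simp [hlo']; omega
      le_lo := by simp [hlo']; omega
      top := by simpa using htop
      flag := by simpa using hflag
      path := hpush
      stack := by
        simpa using hstack.congr (M' := writeBits _ u 1 1) fun q hq =>
          writeBits_of_outside (by omega)
      pos := by simp
      pos_le := Nat.zero_le _ }
  · simp [hout]
  · simp only [potential, Expr.cost, Function.update_apply, reduceCtorEq, ↓reduceIte, hA.dep, hdep,
      hlo']
    omega

end Parts

section Replay
variable {n : ℕ} {adj : Fin n → List (Fin n)} {ℓ w N r lo : ℕ} {inp : ℕ → ℕ} {Q : BState → Prop}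
  {A : BState} {v : Fin n} {e : Fin n × ℕ} {st t : List (Fin n × ℕ)} {S : Finset (Fin n)}

/-- The variables and the memory while the buffer is being rebuilt: the levels from `lo` up to the
length of the suffix `t` of the stack `st` have been restored. -/
structure Replaying (adj : Fin n → List (Fin n)) (ℓ r lo : ℕ) (v : Fin n)
    (st t : List (Fin n × ℕ)) (S : Finset (Fin n)) (ρ : Var → ℕ) (M : ℕ → Bool) : Prop
    extends Ready ℓ r S ρ M where
  cur : ρ .cur = v
  dep : ρ .dep = st.length
  lo_eq : ρ .lo = lo
  top : ρ .top = offset adj ℓ st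
  flag : ρ .flag = 1
  path : SearchPath adj S v st
  suffix : t <:+ st
  lvl : ρ .lvl = t.length
  off : ρ .off = offset adj ℓ t
  nbr : ∀ e, e :: t <:+ st → ρ .nbr = e.1
  stack : StackMem adj ℓ M lo t.length st

theorem exists_cons_suffix {α : Type*} {l t : List α} (h : t <:+ l) (hlt : t.length < l.length) :
    ∃ a, a :: t <:+ l := by
  obtain ⟨p, rfl⟩ := h
  induction p using List.reverseRecOn with
  | nil => simp at hlt
  | append_singleton p a => exact ⟨a, p, by simp⟩

theorem IsPath.getElem?_of_suffix {a b : Fin n × ℕ} (h : IsPath adj v st)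
    (hs : a :: b :: t <:+ st) : (adj b.1)[b.2]? = some a.1 :=
  (h.of_suffix hs).1

theorem wp_replay (hs : Sized adj ℓ w N inp) (hA : Replaying adj ℓ r lo v st t S A.reg A.mem)
    (he : e :: t <:+ st) (hlo : st.length ≤ lo + ℓ)
    (h : ∀ B, Replaying adj ℓ r lo v st (e :: t) S B.reg B.mem → B.out = A.out →
      B.time ≤ A.time + 80 → Q B) :
    replay.wp w inp N Q A := by
  have hB := hs.bounds
  have hb := mod_mul_add_le t.length hs.ell_pos
  have hlen : t.length < st.length := he.length_le
  have hn := hA.path.length_lt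
  have hoff := (offset_le_of_suffix he).trans (hA.path.offset_le (ℓ := ℓ))
  rw [offset_cons] at hoff
  have hslot := slot_le (adj := adj) (ℓ := ℓ) e.1
  have hmin : min (adj e.1).length ℓ = slot adj ℓ e.1 := rfl
  have hst := hA.stack.rebuffer hs he (by omega)
  have hpos := (hst e t he).pos
  have hlt := hA.path.links.lt_length he
  have hfit := hs.array.fits e.1
  simp only [replay, Cmd.wp, Expr.Fits, Expr.val, Arith.Fits, Arith.val, Expr.add_def,
    Expr.mul_def, Expr.mod_def, hA.num, hA.ell, hA.lvl, hA.nbr e he, true_and,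
    hs.input_length]
  refine ⟨by omega, by omega, by omega, by omega, wp_fieldLength fun t₂ ht₂ => ?_⟩
  simp only [Function.update_apply, reduceCtorEq, ↓reduceIte, hA.js, hA.off, hA.ell, hmin,
    hA.nbr e he, hA.lvl, hpos]
  refine ⟨by omega, by omega, by omega, by omega, by omega, by omega, h _ ?_ rfl ?_⟩
  · exact
    { toReady := (hA.toReady.of_mem_eq fun q hq => writeBits_of_outside (by omega)).congr (by simp)
      cur := by simp [hA.cur]
      dep := by simp [hA.dep]
      lo_eq := by simp [hA.lo_eq]
      top := by simp [hA.top]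
      flag := by simp [hA.flag]
      path := hA.path
      suffix := he
      lvl := by simp
      off := by simp [offset_cons, add_comm]
      nbr := fun a ha => by
        simp [(hs.input_neighbor (hA.path.links.getElem?_of_suffix ha)).1]
      stack := hst }
  · simp only [Expr.cost] at ht₂ ⊢
    omega

theorem wp_replay_loop (hs : Sized adj ℓ w N inp) (hlo : st.length ≤ lo + ℓ)
    (hA : Replaying adj ℓ r lo v st t S A.reg A.mem)
    (h : ∀ B, Replaying adj ℓ r lo v st st S B.reg B.mem → B.out = A.out →
      B.time ≤ A.time + 100 * (st.length - t.length) + 1 → Q B) :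
    LoopWP (.lt .lvl .dep) (replay.wp w inp N) Q A := by
  induction hk : st.length - t.length generalizing t A with
  | zero =>
    obtain rfl : t = st := hA.suffix.eq_of_length_le (by omega)
    exact .done (by simp [hA.lvl, hA.dep]) (h _ hA rfl (by simp))
  | succ k ih =>
    obtain ⟨e, he⟩ := exists_cons_suffix hA.suffix (by omega)
    refine .step (fun B => Replaying adj ℓ r lo v st (e :: t) S B.reg B.mem ∧ B.out = A.out ∧
      B.time ≤ A.time + 81) (by simp [hA.lvl, hA.dep]; omega) ?_ ?_
    · exact wp_replay hs hA he hlo fun B hB ho ht => ⟨hB, ho, by simp at ht; omega⟩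
    · rintro B ⟨hB, ho, ht⟩
      have hl : (e :: t).length = t.length + 1 := rfl
      exact ih hB (fun C hC ho' ht' => h C hC (ho'.trans ho) (by omega)) (by omega)

theorem exists_suffix_length {α : Type*} {l : List α} {x : ℕ} (hx : x < l.length) :
    ∃ a t, a :: t <:+ l ∧ t.length = x := by
  obtain ⟨a, ha⟩ := exists_cons_suffix (List.drop_suffix (l.length - x) l) (by simp; omega)
  exact ⟨a, _, ha, by simp; omega⟩

theorem wp_restore (hs : Sized adj ℓ w N inp) (hA : OnPath adj ℓ r v st S A.reg A.mem)
    (hne : st ≠ []) (hlo : A.reg .lo = st.length)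
    (h : ∀ B, OnPath adj ℓ r v st S B.reg B.mem → B.out = A.out → B.reg .lo < st.length →
      potential ℓ B ≤ potential ℓ A + 60 → Q B) :
    restore.wp w inp N Q A := by
  have hB := hs.bounds
  have hn := hA.path.length_lt
  have hlen : 0 < st.length := List.length_pos_iff.2 hne
  have hmod := Nat.mod_lt (st.length - 1) hs.ell_pos
  have hmod' := Nat.mod_le (st.length - 1) ℓ
  obtain ⟨x, hx⟩ : ∃ x, x = st.length - 1 - (st.length - 1) % ℓ := ⟨_, rfl⟩
  have hx₀ : x % ℓ = 0 := hx ▸ Nat.sub_mod_eq_zero_of_mod_eq (by simp)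
  obtain ⟨e, t, he, rfl⟩ := exists_suffix_length (l := st) (x := x) (by omega)
  have hentry := hA.stack e t he
  simp only [restore, Cmd.wp, Expr.Fits, Expr.val, Arith.Fits, Arith.val, Expr.add_def,
    Expr.sub_def, Expr.mul_def, Expr.mod_def, Function.update_apply, reduceCtorEq,
    ↓reduceIte, hA.dep, hA.ell, ← hx, hA.ck, hentry.vertex hx₀, hentry.offset hx₀, true_and]
  refine ⟨by omega, by omega, by omega, by omega, by omega, by omega, by omega, by omega,
    wp_replay_loop hs (st := st) (t := t) (lo := t.length) (v := v) (r := r) (S := S) (by omega)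
      ?_ fun B hB ho ht => h B ?_ ho ?_ ?_⟩
  · exact
    { toReady := hA.toReady.congr (by simp)
      cur := by simp [hA.cur]
      dep := by simp [hA.dep]
      lo_eq := by simp
      top := by simp [hA.top]
      flag := by simp [hA.flag]
      path := hA.path
      suffix := (List.suffix_cons e t).trans he
      lvl := by simp
      off := by simp
      nbr := fun a ha => by
        have := (List.suffix_of_suffix_length_le ha he (by simp)).eq_of_length (by simp)
        simp [List.cons.inj this]
      stack := hA.stack.of_suffix List.suffix_rfl fun d h₁ h₂ => by omega }
  · exact
    { hB with
      lo_le := by rw [hB.lo_eq]; omega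
      le_lo := by rw [hB.lo_eq]; omega
      stack := hB.lo_eq.symm ▸ hB.stack }
  · rw [hB.lo_eq]; omega
  · simp only [potential, Expr.cost, hB.dep, hB.lo_eq, hlo, hA.dep] at ht ⊢
    omega

theorem wp_ascend (hs : Sized adj ℓ w N inp) (hA : OnPath adj ℓ r v (e :: st) S A.reg A.mem)
    (hlo : A.reg .lo ≤ st.length)
    (h : ∀ B, Active adj ℓ r e.1 (e.2 + 1) st S B.reg B.mem → B.out = A.out →
      potential ℓ B ≤ potential ℓ A + 200 → Q B) :
    ascend.wp w inp N Q A := by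
  have hB := hs.bounds
  have hb := mod_mul_add_le st.length hs.ell_pos
  have hoff := hA.path.offset_le (ℓ := ℓ)
  have hslot := slot_le (adj := adj) (ℓ := ℓ) e.1
  have hmin : min (adj e.1).length ℓ = slot adj ℓ e.1 := rfl
  have hentry := hA.stack e st List.suffix_rfl
  have hbuf := hentry.buf hlo (by simp)
  have hj := hA.path.links.lt_length List.suffix_rfl
  have hdeg := length_le_totalDegree (adj := adj) e.1
  have htop := hA.top
  rw [offset_cons] at htop hoff
  have hn := hA.path.length_lt
  have hle := hA.le_lo
  have hdep := hA.dep
  rw [List.length_cons] at hle hdep hn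
  simp only [ascend, Cmd.wp, Expr.Fits, Expr.val, Arith.Fits, Arith.val, Expr.add_def,
    Expr.sub_def, Expr.mul_def, Expr.mod_def, Function.update_apply, reduceCtorEq,
    ↓reduceIte, hdep, hA.ell, hA.num, hbuf, Nat.add_sub_cancel, hs.input_length, true_and]
  refine ⟨by omega, by omega, by omega, by omega, wp_fieldLength fun t₂ ht₂ => ?_⟩
  simp only [Function.update_apply, reduceCtorEq, ↓reduceIte, hA.js, htop, hA.ell, hmin,
    Nat.add_sub_cancel_left, hentry.pos]
  refine ⟨by omega, by omega, by omega, by omega, by omega, h _ ?_ rfl ?_⟩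
  · exact
    { toReady := hA.toReady.congr (by simp)
      cur := by simp
      dep := by simp
      lo_le := by simpa using hlo
      le_lo := by simp; omega
      top := by simp
      flag := by simp [hA.flag]
      path := hA.path.pop
      stack := by
        simpa using hA.stack.of_suffix (List.suffix_cons e st) fun d h₁ h₂ => ⟨h₁, by simp; omega⟩
      pos := by simp
      pos_le := hj }
  · simp only [potential, Expr.cost, Function.update_apply, reduceCtorEq, ↓reduceIte, hdep]
      at ht₂ ⊢
    omega

end Replay

section Step
variable {n : ℕ} {adj : Fin n → List (Fin n)} {ℓ w N r : ℕ} {inp : ℕ → ℕ} {Q : BState → Prop}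
  {A : BState} {u v : Fin n} {j : ℕ} {e : Fin n × ℕ} {st : List (Fin n × ℕ)} {S : Finset (Fin n)}

theorem searchStep_scan (hs : Sized adj ℓ w N inp) (hA : Active adj ℓ r v j st S A.reg A.mem)
    (huv : (adj v)[j]? = some u) (hu : u ∈ S)
    (h : ∀ B, Active adj ℓ r v (j + 1) st S B.reg B.mem → B.out = A.out →
      potential ℓ B ≤ potential ℓ A + 400 → Q B) :
    searchStep.wp w inp N Q A := by
  have hB := hs.bounds
  have hj : j < (adj v).length := (List.getElem?_eq_some_iff.1 huv).1
  have hdeg := length_le_totalDegree (adj := adj) v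
  obtain ⟨hin, hinw⟩ := hs.input_neighbor huv
  simp only [searchStep, Cmd.wp, Expr.Fits, Expr.val, Arith.Fits, Arith.val, Expr.add_def,
    BState.tick, Cond.Holds, Function.update_apply, reduceCtorEq, ↓reduceIte, hA.cur, hA.pos, hin,
    hA.zero, readBits_one, hA.color, hu, hj, hs.input_length, decide_true, Bool.toNat_true,
    one_ne_zero, not_false_eq_true, not_true_eq_false, true_and, IsEmpty.forall_iff, forall_const,
    and_true]
  refine ⟨by omega, by omega, by omega, by omega, by omega, h _ ?_ rfl ?_⟩
  · exact
    { toOnPath := hA.toOnPath.congr (by simp)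
      pos := by simp
      pos_le := hj }
  · simp [potential]
    omega

theorem searchStep_descend (hs : Sized adj ℓ w N inp) (hA : Active adj ℓ r v j st S A.reg A.mem)
    (huv : (adj v)[j]? = some u) (hu : u ∉ S)
    (h : ∀ B, Active adj ℓ r u 0 ((v, j) :: st) (insert u S) B.reg B.mem →
      B.out = A.out ++ [0, (u : ℕ)] → potential ℓ B ≤ potential ℓ A + 400 → Q B) :
    searchStep.wp w inp N Q A := by
  have hB := hs.bounds
  have hj : j < (adj v).length := (List.getElem?_eq_some_iff.1 huv).1
  obtain ⟨hin, hinw⟩ := hs.input_neighbor huv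
  simp only [searchStep, Cmd.wp, Expr.Fits, Expr.val, Arith.Fits, Arith.val, Expr.add_def,
    BState.tick, Cond.Holds, Function.update_apply, reduceCtorEq, ↓reduceIte, hA.cur, hA.pos, hin,
    hA.zero, readBits_one, hA.color, hu, hj, hs.input_length, decide_false, Bool.toNat_false,
    not_true_eq_false, true_and, IsEmpty.forall_iff, forall_const, and_true]
  refine ⟨by omega, by omega, by omega, by omega, wp_descend hs (r := r) (S := S)
    { toOnPath := hA.toOnPath.congr (by simp)
      pos := by simp [hA.pos]
      pos_le := hA.pos_le } (by simp) (by simp) huv hu fun B hB ho ht => h B hB ho (ht.trans ?_)⟩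
  simp [potential]
  omega

theorem searchStep_ascend (hs : Sized adj ℓ w N inp)
    (hA : Active adj ℓ r v (adj v).length (e :: st) S A.reg A.mem)
    (h : ∀ B, Active adj ℓ r e.1 (e.2 + 1) st S B.reg B.mem → B.out = A.out ++ [1, (v : ℕ)] →
      potential ℓ B ≤ potential ℓ A + 400 → Q B) :
    searchStep.wp w inp N Q A := by
  have hB := hs.bounds
  have hlo := hA.lo_le
  rw [List.length_cons] at hlo
  simp only [searchStep, Cmd.wp, Expr.Fits, Expr.val, BState.tick, Cond.Holds,
    Function.update_apply, reduceCtorEq, ↓reduceIte, hA.cur, hA.pos, hA.zero, hA.dep,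
    hs.input_length, lt_irrefl, List.length_cons, Nat.add_eq_zero_iff, one_ne_zero, and_false,
    not_false_eq_true, true_and, IsEmpty.forall_iff, forall_const]
  refine ⟨by omega, fun heq => ?_, fun hne => ?_⟩
  · refine wp_restore hs (r := r) (v := v) (st := e :: st) (S := S)
      (hA.toOnPath.congr (by simp)) (by simp) (by simp [heq]) fun B hB ho hlt ht =>
      wp_ascend hs hB (Nat.lt_succ_iff.1 hlt) fun C hC ho' ht' => h C hC (by simp [ho', ho])
        (ht'.trans ((Nat.add_le_add_right ht _).trans ?_))
    simp [potential]
    omega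
  · refine wp_ascend hs (r := r) (v := v) (e := e) (st := st) (S := S)
      (hA.toOnPath.congr (by simp)) (by simp; omega) fun C hC ho' ht' =>
      h C hC (by simp [ho']) (ht'.trans ?_)
    simp [potential]
    omega

/-- The variables and the memory between two searches. -/
structure Between (ℓ r : ℕ) (S : Finset (Fin n)) (ρ : Var → ℕ) (M : ℕ → Bool) : Prop
    extends Ready ℓ r S ρ M where
  dep : ρ .dep = 0
  lo : ρ .lo = 0
  top : ρ .top = 0

theorem searchStep_last (hs : Sized adj ℓ w N inp)
    (hA : Active adj ℓ r v (adj v).length [] S A.reg A.mem)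
    (h : ∀ B, Between ℓ r S B.reg B.mem → B.reg .flag = 0 → B.out = A.out ++ [1, (v : ℕ)] →
      potential ℓ B ≤ potential ℓ A + 400 → Q B) :
    searchStep.wp w inp N Q A := by
  have hB := hs.bounds
  simp only [searchStep, Cmd.wp, Expr.Fits, Expr.val, BState.tick, Cond.Holds,
    Function.update_apply, reduceCtorEq, ↓reduceIte, hA.cur, hA.pos, hA.zero, hA.dep,
    hs.input_length, lt_irrefl, List.length_nil, not_true_eq_false, not_false_eq_true, true_and,
    IsEmpty.forall_iff, forall_const, and_true]
  refine ⟨by omega, by omega, h _ ?_ (by simp) (by simp) ?_⟩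
  · exact
    { toReady := hA.toReady.congr (by simp)
      dep := by simp [hA.dep]
      lo := by simpa using hA.lo_le
      top := by simpa [offset] using hA.top }
  · simp [potential]
    omega

end Step

/-! ## The search as a whole -/

section Search
variable {n : ℕ} {adj : Fin n → List (Fin n)} {ℓ w N r : ℕ} {inp : ℕ → ℕ} {Q : BState → Prop}
  {A : BState} {v : Fin n} {j : ℕ} {st : List (Fin n × ℕ)} {S S' : Finset (Fin n)}
  {vs : List (Fin n)} {es : List (DFSEvent (Fin n))}

/-- The number of search steps charged to a set of vertices. -/
def weight (adj : Fin n → List (Fin n)) (S : Finset (Fin n)) : ℕ :=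
  ∑ u ∈ S, ((adj u).length + 1)

theorem weight_insert (h : v ∉ S) :
    weight adj (insert v S) = (adj v).length + 1 + weight adj S :=
  Finset.sum_insert h

theorem weight_le : weight adj S ≤ totalDegree adj + n := by
  refine (Finset.sum_le_sum_of_subset (Finset.subset_univ S)).trans ?_
  simp [Finset.sum_add_distrib, totalDegree]

theorem cons_eq_drop_iff {α : Type*} {a : α} {l l' : List α} {i : ℕ} :
    a :: l' = l.drop i ↔ l[i]? = some a ∧ l' = l.drop (i + 1) := by
  rw [← List.head?_drop, ← List.tail_drop]
  cases l.drop i <;> simp [eq_comm]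

theorem searchLoop_scan (hs : Sized adj ℓ w N inp) (hscan : DFSScan adj vs S es S')
    (hvs : vs = (adj v).drop j) (hA : Active adj ℓ r v j st S A.reg A.mem)
    (h : ∀ B, Active adj ℓ r v (adj v).length st S' B.reg B.mem →
      B.out = A.out ++ es.flatMap DFSEvent.encode →
      potential ℓ B + 401 * weight adj S ≤
        potential ℓ A + 401 * (vs.length + weight adj S') →
      LoopWP (.ne .flag .zero) (searchStep.wp w inp N) Q B) :
    LoopWP (.ne .flag .zero) (searchStep.wp w inp N) Q A := by
  induction hscan generalizing v j st A with
  | nil S =>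
    obtain rfl := hA.pos_le.antisymm (List.drop_eq_nil_iff.1 hvs.symm)
    exact h A hA (by simp) (by simp)
  | skip hu _ ih =>
    obtain ⟨hget, hdrop⟩ := cons_eq_drop_iff.1 hvs
    refine .step _ (by simp [hA.flag, hA.zero])
      (searchStep_scan hs (A := A.tick) hA hget hu fun B hB ho ht => ?_) fun B hB => hB
    refine ih hdrop hB fun C hC ho' ht' => h C hC (by rw [ho', ho, BState.tick]) ?_
    simp only [potential, BState.tick, List.length_cons] at *
    omega
  | visit hu _ _ ih₁ ih₂ =>
    obtain ⟨hget, hdrop⟩ := cons_eq_drop_iff.1 hvs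
    refine .step _ (by simp [hA.flag, hA.zero])
      (searchStep_descend hs (A := A.tick) hA hget hu fun B hB ho ht => ?_) fun B hB => hB
    refine ih₁ (by simp) hB fun C hC hoC htC => ?_
    refine .step _ (by simp [hC.flag, hC.zero])
      (searchStep_ascend hs (A := C.tick) hC fun D hD hoD htD => ?_) fun B hB => hB
    refine ih₂ hdrop hD fun E hE hoE htE => h E hE ?_ ?_
    · simp [hoE, hoD, BState.tick, hoC, ho, DFSEvent.encode]
    · rw [weight_insert hu] at htC
      simp only [potential, BState.tick, List.length_cons] at *
      omega

theorem wp_search (hs : Sized adj ℓ w N inp) (hA : Between ℓ v S A.reg A.mem) (hv : v ∉ S)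
    (hscan : DFSScan adj (adj v) (insert v S) es S')
    (h : ∀ B, Between ℓ v S' B.reg B.mem →
      B.out = A.out ++ [0, (v : ℕ)] ++ es.flatMap DFSEvent.encode ++ [1, (v : ℕ)] →
      potential ℓ B + 401 * weight adj S ≤ potential ℓ A + 401 * weight adj S' + 500 → Q B) :
    search.wp w inp N Q A := by
  have hB := hs.bounds
  simp only [search, Cmd.wp, Expr.Fits, Expr.val, hA.root, true_and]
  refine ⟨by omega, by omega, by omega, by omega, by norm_num, by omega, by omega, by omega,
    searchLoop_scan hs hscan (r := v) (v := v) (j := 0) (st := []) rfl ?_ fun B hB ho ht => ?_⟩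
  · exact
    { toReady := (hA.toReady.insert v).congr (by simp)
      cur := by simp
      dep := by simp [hA.dep]
      lo_le := by simp [hA.lo]
      le_lo := by simp
      top := by simp [hA.top, offset]
      flag := by simp
      path := ⟨trivial, by simp, by simp⟩
      stack := .nil
      pos := by simp
      pos_le := Nat.zero_le _ }
  · refine .step _ (by simp [hB.flag, hB.zero])
      (searchStep_last hs (A := B.tick) hB fun C hC hflag hoC htC => ?_) fun B hB => hB
    refine .done (by simp [hflag, hC.zero]) (h _ hC (by simp [hoC, ho, BState.tick]) ?_)
    rw [weight_insert hv] at ht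
    simp [potential] at *
    omega

end Search

section Roots
variable {n : ℕ} {adj : Fin n → List (Fin n)} {ℓ w N r r' : ℕ} {inp : ℕ → ℕ} {Q : BState → Prop}
  {A : BState} {v : Fin n} {S S' : Finset (Fin n)} {vs : List (Fin n)}
  {es : List (DFSEvent (Fin n))} {ρ ρ' : Var → ℕ} {M : ℕ → Bool}

theorem Between.congr (h : Between ℓ r S ρ M)
    (hρ : ∀ x ∈ [Var.num, .ell, .ck, .js, .zero, .dep, .lo, .top], ρ' x = ρ x)
    (hr : ρ' .root = r') : Between ℓ r' S ρ' M where
  num := (hρ _ (by simp)).trans h.num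
  ell := (hρ _ (by simp)).trans h.ell
  ck := (hρ _ (by simp)).trans h.ck
  js := (hρ _ (by simp)).trans h.js
  zero := (hρ _ (by simp)).trans h.zero
  root := hr
  color := h.color
  dep := (hρ _ (by simp)).trans h.dep
  lo := (hρ _ (by simp)).trans h.lo
  top := (hρ _ (by simp)).trans h.top

theorem rootStep_skip (hs : Sized adj ℓ w N inp) (hA : Between ℓ v S A.reg A.mem) (hv : v ∈ S)
    (h : ∀ B, Between ℓ (v + 1) S B.reg B.mem → B.out = A.out →
      potential ℓ B ≤ potential ℓ A + 100 → Q B) :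
    rootStep.wp w inp N Q A := by
  have hB := hs.bounds
  simp only [rootStep, Cmd.wp, Expr.Fits, Expr.val, Arith.Fits, Arith.val, Expr.add_def,
    BState.tick, Cond.Holds, Function.update_apply, reduceCtorEq, ↓reduceIte, hA.root,
    readBits_one, hA.color, hv, hA.zero, decide_true, Bool.toNat_true, one_ne_zero,
    not_false_eq_true, true_and, IsEmpty.forall_iff, forall_const]
  refine ⟨by omega, by omega, by omega, by omega, h _ (hA.congr (by simp) (by simp)) rfl ?_⟩
  simp [potential]
  omega

theorem rootStep_visit (hs : Sized adj ℓ w N inp) (hA : Between ℓ v S A.reg A.mem) (hv : v ∉ S)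
    (hscan : DFSScan adj (adj v) (insert v S) es S')
    (h : ∀ B, Between ℓ (v + 1) S' B.reg B.mem →
      B.out = A.out ++ [0, (v : ℕ)] ++ es.flatMap DFSEvent.encode ++ [1, (v : ℕ)] →
      potential ℓ B + 401 * weight adj S ≤ potential ℓ A + 401 * weight adj S' + 550 → Q B) :
    rootStep.wp w inp N Q A := by
  have hB := hs.bounds
  simp only [rootStep, Cmd.wp, Expr.Fits, Expr.val, Arith.Fits, Arith.val, Expr.add_def,
    BState.tick, Cond.Holds, Function.update_apply, reduceCtorEq, ↓reduceIte, hA.root,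
    readBits_one, hA.color, hv, hA.zero, decide_false, Bool.toNat_false, not_true_eq_false,
    true_and, IsEmpty.forall_iff, forall_const, and_true]
  refine ⟨by omega, by omega, by omega, wp_search hs (v := v) (S := S)
    (hA.congr (by simp) (by simp [hA.root])) hv hscan fun B hB ho ht =>
    ⟨by rw [hB.root]; omega, h _ (hB.congr (by simp) (by simp [hB.root])) ho ?_⟩⟩
  simp [potential] at ht ⊢
  omega

theorem cons_eq_drop_finRange (h : v :: vs = (List.finRange n).drop r) :
    r = v ∧ vs = (List.finRange n).drop (r + 1) := by
  obtain ⟨hget, hdrop⟩ := cons_eq_drop_iff.1 h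
  obtain ⟨hr, rfl⟩ := List.getElem?_eq_some_iff.1 hget
  exact ⟨by simp, hdrop⟩

theorem rootLoop_scan (hs : Sized adj ℓ w N inp) (hscan : DFSScan adj vs S es S')
    (hvs : vs = (List.finRange n).drop r) (hA : Between ℓ r S A.reg A.mem)
    (h : ∀ B, B.out = A.out ++ es.flatMap DFSEvent.encode →
      potential ℓ B + 401 * weight adj S ≤
        potential ℓ A + 401 * weight adj S' + 600 * vs.length + 1 → Q B) :
    LoopWP (.lt .root .num) (rootStep.wp w inp N) Q A := by
  induction hscan generalizing r A with
  | nil S =>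
    have hr : n ≤ r := by simpa using hvs.symm
    refine .done (by simp [hA.root, hA.num, hr]) (h _ (by simp) ?_)
    simp [potential]
    omega
  | skip hv _ ih =>
    obtain ⟨rfl, hdrop⟩ := cons_eq_drop_finRange hvs
    refine .step _ (by simp [hA.root, hA.num])
      (rootStep_skip hs (A := A.tick) hA hv fun B hB ho ht => ?_) fun B hB => hB
    refine ih hdrop hB fun C ho' ht' => h C (by rw [ho', ho, BState.tick]) ?_
    simp only [potential, BState.tick, List.length_cons] at *
    omega
  | visit hv hscan₁ _ _ ih =>
    obtain ⟨rfl, hdrop⟩ := cons_eq_drop_finRange hvs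
    refine .step _ (by simp [hA.root, hA.num])
      (rootStep_visit hs (A := A.tick) hA hv hscan₁ fun B hB ho ht => ?_) fun B hB => hB
    refine ih hdrop hB fun C ho' ht' => h C (by simp [ho', ho, BState.tick, DFSEvent.encode]) ?_
    simp only [potential, BState.tick, List.length_cons] at *
    omega

end Roots

/-! ## Initialization -/

section Setup
variable {n : ℕ} {adj : Fin n → List (Fin n)} {w N k t : ℕ} {inp : ℕ → ℕ} {Q : BState → Prop}
  {A : BState} {M : ℕ → Bool}

/-- The state in which the program starts: the memory `M` is arbitrary. -/
def BState.initial (n : ℕ) (M : ℕ → Bool) : BState :=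
  ⟨Function.update 0 .num n, M, [], 0⟩

theorem describes_initial {work : ℕ → ℕ} (hn : n < 2 ^ w) (hwork : ∀ a, work a < 2 ^ w) :
    Describes w N (.initial n (bits w work)) (initial n w work) where
  bounded := ⟨fun r => by have := Nat.lt_two_pow_self (n := w); simp only [initial]; grind, hwork⟩
  wordSize := rfl
  reg a := by cases a <;> simp [initial, BState.initial, Var.idx]
  mem := rfl
  out := rfl
  time := rfl
  cells := Nat.zero_le _

theorem sum_input_length (harr : IsAdjacencyArray w adj inp) :
    ∑ i ∈ Finset.range n, inp (inp i) = totalDegree adj := by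
  rw [← Fin.sum_univ_eq_sum_range (fun i => inp (inp i)), totalDegree]
  exact Finset.sum_congr rfl fun u _ => harr.length u

/-- The state in which the first `k` vertices have been marked undiscovered and their degrees
have been summed up. -/
structure Cleared (n : ℕ) (inp : ℕ → ℕ) (k : ℕ) (A : BState) : Prop where
  num : A.reg .num = n
  root : A.reg .root = k
  total : A.reg .total = n + ∑ i ∈ Finset.range k, inp (inp i)
  others : ∀ x ∉ [Var.num, .root, .total], A.reg x = 0
  clear : ∀ q < k, A.mem q = false
  out : A.out = []
  time : A.time ≤ 2 + 50 * k

theorem wp_clearStep (harr : IsAdjacencyArray w adj inp) (hw : 1 < w) (hN : n ≤ N)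
    (hlim : n + totalDegree adj + 1 < 2 ^ w) (hk : k < n) (hA : Cleared n inp k A) :
    clearStep.wp w inp N (Cleared n inp (k + 1)) A.tick := by
  have hle : ∑ i ∈ Finset.range (k + 1), inp (inp i) ≤ totalDegree adj := by
    rw [← sum_input_length harr]
    exact Finset.sum_le_sum_of_subset (Finset.range_mono hk)
  rw [Finset.sum_range_succ] at hle
  have htime := hA.time
  simp only [clearStep, Cmd.wp, Expr.Fits, Expr.val, Arith.Fits, Arith.val, Expr.add_def,
    BState.tick, Function.update_apply, reduceCtorEq, ↓reduceIte, hA.root, hA.total, true_and]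
  refine ⟨by omega, by omega, by omega, by omega, by omega, by omega, by omega, ?_⟩
  exact
  { num := by simp [hA.num]
    root := by simp
    total := by simp [Finset.sum_range_succ, add_assoc]
    others := by
      intro x hx
      have := hA.others x hx
      simp_all
    clear := by
      intro q hq
      rcases eq_or_ne q k with rfl | hqk
      · simp [writeBits]
      · exact (writeBits_of_outside (by omega)).trans (hA.clear q (by omega))
    out := hA.out
    time := by simp; omega }

theorem clearLoop_cleared (harr : IsAdjacencyArray w adj inp) (hw : 1 < w) (hN : n ≤ N)
    (hlim : n + totalDegree adj + 1 < 2 ^ w) (hk : k ≤ n) (hA : Cleared n inp k A)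
    (h : ∀ B, Cleared n inp n B → Q B.tick) :
    LoopWP (.lt .root .num) (clearStep.wp w inp N) Q A := by
  induction hk using Nat.decreasingInduction generalizing A with
  | self => exact .done (by simp [hA.root, hA.num]) (h A hA)
  | of_succ k hk ih =>
    exact .step _ (by simpa [hA.root, hA.num]) (wp_clearStep harr hw hN hlim hk hA)
      fun B hB => ih hB

theorem two_pow_size_le (ht : 0 < t) : 2 ^ t.size ≤ 2 * t := by
  have h : 0 < t.size := Nat.size_pos.2 ht
  have h' : 2 ^ (t.size - 1) ≤ t := Nat.lt_size.1 (by omega)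
  calc 2 ^ t.size = 2 ^ (t.size - 1 + 1) := by rw [Nat.sub_add_cancel h]
    _ ≤ 2 * t := by rw [pow_succ]; omega

/-- The state in which the powers of two below `2 ^ k` have been compared to `t`, in order to
compute the bit length of `t`. -/
structure Measured (n t k : ℕ) (A : BState) : Prop where
  num : A.reg .num = n
  total : A.reg .total = t
  ell : A.reg .ell = k
  pw : A.reg .pw = 2 ^ k
  others : ∀ x ∉ [Var.num, .total, .ell, .pw], A.reg x = 0
  clear : ∀ q < n, A.mem q = false
  out : A.out = []
  time : A.time ≤ 50 * n + 7 + 10 * k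

theorem wp_lengthStep (hlim : 2 * t + 1 < 2 ^ w) (hk : 2 ^ k ≤ t) (hA : Measured n t k A) :
    lengthStep.wp w inp N (Measured n t (k + 1)) A.tick := by
  have hk' : k < 2 ^ k := Nat.lt_two_pow_self
  have htime := hA.time
  simp only [lengthStep, Cmd.wp, Expr.Fits, Expr.val, Arith.Fits, Arith.val, Expr.add_def,
    BState.tick, Function.update_apply, reduceCtorEq, ↓reduceIte, hA.pw, hA.ell, true_and]
  refine ⟨by omega, by omega, ?_⟩
  exact
  { num := by simp [hA.num]
    total := by simp [hA.total]
    ell := by simp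
    pw := by simp [pow_succ, mul_two]
    others := by
      intro x hx
      have := hA.others x hx
      simp_all
    clear := hA.clear
    out := hA.out
    time := by simp; omega }

theorem lengthLoop_measured (hlim : 2 * t + 1 < 2 ^ w) (hk : k ≤ t.size)
    (hA : Measured n t k A) (h : ∀ B, Measured n t t.size B → Q B.tick) :
    LoopWP (.le .pw .total) (lengthStep.wp w inp N) Q A := by
  induction hk using Nat.decreasingInduction generalizing A with
  | self => exact .done (by simp [hA.pw, hA.total, Nat.lt_size_self]) (h A hA)
  | of_succ k hk ih =>
    have hle : 2 ^ k ≤ t := Nat.lt_size.1 hk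
    exact .step _ (by simpa [hA.pw, hA.total]) (wp_lengthStep hlim hle hA) fun B hB => ih hB

theorem wp_setup (hs : Sized adj (n + totalDegree adj).size w N inp)
    (hlim : 2 * (n + totalDegree adj) + 1 < 2 ^ w)
    (h : ∀ B, Between (n := n) (n + totalDegree adj).size 0 ∅ B.reg B.mem → B.out = [] →
      B.time ≤ 50 * n + 10 * (n + totalDegree adj).size + 50 → Q B) :
    setup.wp w inp N Q (.initial n M) := by
  have hB := hs.bounds
  simp only [setup, Cmd.wp, Expr.Fits, Expr.val, Arith.Fits, Arith.val, Expr.add_def, Expr.mul_def,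
    true_and]
  refine clearLoop_cleared hs.array (by omega) (by omega) (by omega) (Nat.zero_le _)
    { num := by simp [BState.initial]
      root := by simp [BState.initial]
      total := by simp [BState.initial]
      others := by simp +contextual [BState.initial]
      clear := by simp
      out := rfl
      time := by simp [BState.initial] } fun B hB' => ?_
  have htotal := hB'.total
  rw [sum_input_length hs.array] at htotal
  have htime := hB'.time
  refine ⟨by omega, by omega, lengthLoop_measured hlim (Nat.zero_le _)
    { num := by simp [hB'.num]
      total := by simp [htotal]
      ell := by simp [hB'.others]
      pw := by simp
      others := ?_
      clear := hB'.clear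
      out := hB'.out
      time := by simp; omega } fun C hC => ?_⟩
  · intro x hx
    have := hB'.others x
    simp_all [Function.update_apply]
  have htime' := hC.time
  simp only [BState.tick, Function.update_apply, reduceCtorEq, ↓reduceIte, hC.num, hC.ell]
  refine ⟨by omega, by omega, h _
    { num := by simp [hC.num]
      ell := by simp [hC.ell]
      ck := by simp [ckBase]
      js := by simp [ckBase, jsBase]
      zero := by simp [hC.others]
      root := by simp [hC.others]
      color := fun u => by simpa using hC.clear u u.2
      dep := by simp [hC.others]
      lo := by simp [hC.others]
      top := by simp [hC.others] } hC.out ?_⟩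
  simp
  omega

end Setup

/-! ## The traversal -/

section Traversal
variable {n : ℕ} {adj : Fin n → List (Fin n)} {w N m : ℕ} {inp : ℕ → ℕ} {Q : BState → Prop}

theorem sq_le_two_pow (k : ℕ) : k * k ≤ 2 * 2 ^ k := by
  induction k with
  | zero => norm_num
  | succ k ih =>
    rw [pow_succ]
    rcases Nat.lt_or_ge k 3 with hk | hk
    · interval_cases k <;> norm_num
    · nlinarith

theorem jsBase_size_le (hn : 0 < n) :
    jsBase n (n + totalDegree adj).size ≤ 11 * n + 8 * totalDegree adj := by
  have h₁ := two_pow_size_le (t := n + totalDegree adj) (by omega)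
  have h₂ := sq_le_two_pow (n + totalDegree adj).size
  have h₃ := Nat.lt_two_pow_self (n := (n + totalDegree adj).size)
  unfold jsBase ckBase
  omega

theorem sized_size (harr : IsAdjacencyArray w adj inp) (hn : 0 < n)
    (hw : 11 * n + 9 * totalDegree adj + 1 < 2 ^ w) :
    Sized adj (n + totalDegree adj).size w
      (jsBase n (n + totalDegree adj).size + totalDegree adj) inp where
  array := harr
  ell_pos := Nat.size_pos.2 (by omega)
  total_lt := Nat.lt_size_self _
  ell_lt := by
    have := two_pow_size_le (t := n + totalDegree adj) (by omega)
    exact (Nat.pow_lt_pow_iff_right one_lt_two).1 (by omega)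
  limit_eq := rfl
  limit_lt := by
    have := jsBase_size_le (adj := adj) hn
    omega

theorem wp_dfs (hs : Sized adj (n + totalDegree adj).size w N inp) (hn : 0 < n)
    (hlim : 2 * (n + totalDegree adj) + 1 < 2 ^ w) {M : ℕ → Bool} {S : Finset (Fin n)}
    {es : List (DFSEvent (Fin n))} (hscan : DFSScan adj (List.finRange n) ∅ es S)
    (h : ∀ B, B.out = es.flatMap DFSEvent.encode →
      B.time ≤ 2000 * (n + totalDegree adj) → Q B) :
    dfs.wp w inp N Q (.initial n M) := by
  have hsize : (n + totalDegree adj).size ≤ n + totalDegree adj :=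
    Nat.size_le.2 Nat.lt_two_pow_self
  have hweight := weight_le (adj := adj) (S := S)
  refine wp_setup hs hlim fun B hB ho ht => ?_
  refine rootLoop_scan hs hscan (by simp) hB fun C ho' ht' => h C (by simp [ho', ho]) ?_
  simp only [potential, hB.dep, hB.lo, List.length_finRange] at ht'
  omega

theorem performsDFS (hn : 0 < n) (hm : totalDegree adj ≤ 2 * m)
    (hw : 64 * (n + m + 1) ≤ 2 ^ w) :
    PerformsDFS dfs.code adj w ((dfs.code.regs + 5000) * (n + m))
      ((dfs.code.regs + 5000) * (n + m + w)) := by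
  intro inp work harr hwork
  have hs := sized_size harr hn (by omega)
  obtain ⟨es, S, hscan⟩ := DFSScan.exists adj ∅ (List.finRange n)
  obtain ⟨τ, B, run, hB, hout, htime⟩ := dfs.code_runs harr.word hs.limit_lt
    (describes_initial (by omega) hwork)
    (wp_dfs hs hn (by omega) hscan (Q := fun B => B.out = es.flatMap DFSEvent.encode ∧
      B.time ≤ 2000 * (n + totalDegree adj)) fun _ ho ht => ⟨ho, ht⟩)
  refine ⟨τ, es, run, ⟨S, hscan⟩, hB.out.trans hout, ?_, ?_⟩
  · rw [hB.time]
    nlinarith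
  · have hN : jsBase n (n + totalDegree adj).size + totalDegree adj ≤ 20 * (n + m) := by
      have := jsBase_size_le (adj := adj) hn
      omega
    have hcells := hB.cells
    set N := jsBase n (n + totalDegree adj).size + totalDegree adj
    have hdiv : w * (N / w) ≤ N := Nat.mul_div_le N w
    calc w * (dfs.code.regs + τ.cells) ≤ w * (dfs.code.regs + (N / w + 2)) := by gcongr
      _ = w * dfs.code.regs + w * (N / w) + 2 * w := by ring
      _ ≤ (dfs.code.regs + 5000) * (n + m + w) := by nlinarith

end Traversal

end WordRAM

section Graph
variable {n : ℕ} {adj : Fin n → List (Fin n)}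

theorem ListsNeighbors.card {Adj : Fin n → Fin n → Prop} (h : ListsNeighbors Adj adj)
    (u : Fin n) : Nat.card {v // Adj u v} = (adj u).length := by
  rw [Nat.subtype_card (adj u).toFinset fun v => by rw [List.mem_toFinset, (h u).2 v],
    List.toFinset_card_of_nodup (h u).1]

theorem sum_length_digraph {G : Digraph (Fin n)} (h : ListsNeighbors G.Adj adj) :
    ∑ u, (adj u).length = Nat.card {e : Fin n × Fin n // G.Adj e.1 e.2} := by
  rw [Nat.card_congr (Equiv.subtypeProdEquivSigmaSubtype fun u v => G.Adj u v), Nat.card_sigma]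
  exact Finset.sum_congr rfl fun u _ => (h.card u).symm

theorem sum_length_simpleGraph {G : SimpleGraph (Fin n)} (h : ListsNeighbors G.Adj adj) :
    ∑ u, (adj u).length = 2 * Nat.card G.edgeSet := by
  classical
  rw [Nat.card_eq_fintype_card, ← SimpleGraph.edgeFinset_card,
    ← G.sum_degrees_eq_twice_card_edges]
  refine Finset.sum_congr rfl fun u _ => ?_
  rw [← h.card u, ← G.card_neighborSet_eq_degree u, ← Nat.card_eq_fintype_card]
  rfl

end Graph

theorem two_pow_mul_le_of_clog_add_le {x k w : ℕ} (h : Nat.clog 2 x + k ≤ w) :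
    2 ^ k * x ≤ 2 ^ w :=
  calc 2 ^ k * x ≤ 2 ^ k * 2 ^ Nat.clog 2 x := by
        gcongr
        exact Nat.le_pow_clog one_lt_two x
    _ = 2 ^ (Nat.clog 2 x + k) := by rw [pow_add, mul_comm]
    _ ≤ 2 ^ w := Nat.pow_le_pow_right two_pos h

theorem theorem3_general :
    ∃ (P : WordRAM.Program) (k C : ℕ), ∀ (n : ℕ) (adj : Fin n → List (Fin n)) (m w : ℕ),
      0 < n → ∑ u, (adj u).length ≤ 2 * m → Nat.clog 2 (n + m + 1) + k ≤ w →
      WordRAM.PerformsDFS P adj w (C * (n + m)) (C * (n + m + w)) :=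
  ⟨WordRAM.dfs.code, 6, WordRAM.dfs.code.regs + 5000, fun _ _ _ _ hn hm hw =>
    WordRAM.performsDFS hn hm (by simpa using two_pow_mul_le_of_clog_add_le hw)⟩

theorem theorem3 :
    ∃ (P : WordRAM.Program) (k C : ℕ),
      (∀ (n : ℕ) (G : Digraph (Fin n)) (adj : Fin n → List (Fin n)) (m w : ℕ),
        0 < n → ListsNeighbors G.Adj adj →
        m = Nat.card {e : Fin n × Fin n // G.Adj e.1 e.2} →
        Nat.clog 2 (n + m + 1) + k ≤ w →
        WordRAM.PerformsDFS P adj w (C * (n + m)) (C * (n + m + w))) ∧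
      (∀ (n : ℕ) (G : SimpleGraph (Fin n)) (adj : Fin n → List (Fin n)) (m w : ℕ),
        0 < n → ListsNeighbors G.Adj adj →
        m = Nat.card G.edgeSet →
        Nat.clog 2 (n + m + 1) + k ≤ w →
        WordRAM.PerformsDFS P adj w (C * (n + m)) (C * (n + m + w))) := by
  obtain ⟨P, k, C, h⟩ := theorem3_general
  refine ⟨P, k, C, fun n G adj m w hn hadj hm => h n adj m w hn ?_,
    fun n G adj m w hn hadj hm => h n adj m w hn ?_⟩
  · have := sum_length_digraph hadj
    omega
  · have := sum_length_simpleGraph hadj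
    omega
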